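/- **Proposition 4.1 (Representation).** Let $a>0$, $U>0$ and $M=U/a<1$. Put $c=\dfrac{M}{a(1-M^2)}$, $\lambda(s)=-\dfrac{s(1+cU)}{U}$, let $H_0^{(1)}=J_0+iY_0$ be the Hankel function of the first kind of order $0$ (principal branch), and let $$z=\frac{is}{a\sqrt{1-M^2}}\sqrt{\frac{(x-\xi)^2}{1-M^2}+(y-\eta)^2},\qquad \zeta=\frac{is}{a\sqrt{1-M^2}}\sqrt{\frac{(u-\xi)^2}{1-M^2}+(y-\eta)^2}.$$ Then there are functions $K,A,B$ of $x,\xi\in[-1,1]$ and of $s$ with $\operatorname{Re}s>0$ such that, for all such $s$ and all $x,\xi\in[-1,1]$ with $x\ne\xi$, the derivative and the (absolutely convergent) integral below exist for every $y>0$, and the kernel of the generalized Possio equation satisfies $$\lim_{y\to0^+}\left[\frac{1-M^2}{U}\frac{\partial H_0^{(1)}}{\partial x}(z)+\frac{\lambda(s)(1-M^2)}{U}H_0^{(1)}(z)+\frac{e^{\lambda(s)x}}{U}\left(\lambda^2(s)(1-M^2)-\frac{s^2}{a^2(1-M^2)}\right)\int_{-\infty}^x e^{-\lambda(s)u}H_0^{(1)}(\zeta)\,du\right]\Bigg|_{\eta=0}$$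 $$=\frac{2i(1-M^2)}{\pi U}\cdot\frac1{x-\xi}+K(x,\xi,s),\qquad K(x,\xi,s)=A(x,\xi,s)\log|x-\xi|+B(x,\xi,s).$$ For all $x,\xi\in[-1,1]$ the functions $A(x,\xi,\cdot)$ and $B(x,\xi,\cdot)$ are analytic in $\operatorname{Re}s>0$. Moreover, for every $\sigma_1>0$ there is a constant $C$, which may depend on $a$, $U$ and $\sigma_1$ but not on $x$, $\xi$, $s$, such that $$|A(x,\xi,s)|<C|s|^2,\qquad |B(x,\xi,s)|<C|s|^2\qquad\text{for all }x,\xi\in[-1,1]\text{ and all }s\text{ with }\operatorname{Re}s\ge\sigma_1;$$ in particular $A$ and $B$ are bounded in $x,\xi$ for each fixed $s$. -/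

import Mathlib

open Set Filter Topology MeasureTheory

noncomputable section

/-- The Bessel function `J₀` of the first kind of order `0`, by its (everywhere convergent) power
series `J₀(z) = ∑ (-1)^k (z/2)^(2k) / (k!)²`. -/
def besselJZero (z : ℂ) : ℂ :=
  ∑' k : ℕ, (-1 : ℂ) ^ k / ((k.factorial : ℂ) ^ 2) * (z / 2) ^ (2 * k)

/-- The Bessel function `Y₀` of the second kind of order `0` (principal branch),
`Y₀(z) = (2/π) (log (z/2) + γ) J₀(z) - (2/π) ∑ (-1)^k h_k (z/2)^(2k) / (k!)²`, where `γ` is the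
Euler-Mascheroni constant and `h_k = 1 + 1/2 + ⋯ + 1/k`. -/
def besselYZero (z : ℂ) : ℂ :=
  (2 / (Real.pi : ℂ)) *
      (Complex.log (z / 2) + (Real.eulerMascheroniConstant : ℂ)) * besselJZero z
    - (2 / (Real.pi : ℂ)) *
      ∑' k : ℕ, (-1 : ℂ) ^ k * ((harmonic k : ℚ) : ℂ) / ((k.factorial : ℂ) ^ 2)
        * (z / 2) ^ (2 * k)

/-- The Hankel function of the first kind of order `0`: `H₀⁽¹⁾ = J₀ + i Y₀`. -/
def hankelZero (z : ℂ) : ℂ := besselJZero z + Complex.I * besselYZero z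

namespace Possio

/-- The argument `z = (i s / (a √(1-M²))) √((x-ξ)²/(1-M²) + (y-η)²)`; with `u` in place of `x` this
is `ζ`. -/
def arg (a M : ℝ) (s : ℂ) (ξ η x y : ℝ) : ℂ :=
  (Complex.I * s / ((a * Real.sqrt (1 - M ^ 2) : ℝ) : ℂ)) *
    ((Real.sqrt ((x - ξ) ^ 2 / (1 - M ^ 2) + (y - η) ^ 2) : ℝ) : ℂ)

/-- `c = M / (a (1-M²))`. -/
def c (a M : ℝ) : ℝ := M / (a * (1 - M ^ 2))

/-- `λ(s) = - s (1 + c U) / U`. -/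
def lam (a U M : ℝ) (s : ℂ) : ℂ := -(s * ((1 + c a M * U : ℝ) : ℂ) / (U : ℂ))

/-- The expression in square brackets in the generalized Possio equation, at `η = 0`. Its limit as
`y → 0⁺` is the kernel of the equation. -/
def bracket (a U M : ℝ) (s : ℂ) (x ξ y : ℝ) : ℂ :=
  ((1 - M ^ 2 : ℝ) : ℂ) / (U : ℂ) * deriv (fun x' : ℝ => hankelZero (arg a M s ξ 0 x' y)) x
    + lam a U M s * ((1 - M ^ 2 : ℝ) : ℂ) / (U : ℂ) * hankelZero (arg a M s ξ 0 x y)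
    + Complex.exp (lam a U M s * (x : ℂ)) / (U : ℂ)
      * (lam a U M s ^ 2 * ((1 - M ^ 2 : ℝ) : ℂ) - s ^ 2 / ((a ^ 2 * (1 - M ^ 2) : ℝ) : ℂ))
      * ∫ u in Iic x, Complex.exp (-(lam a U M s * (u : ℂ))) * hankelZero (arg a M s ξ 0 u y)

end Possio

end

/-!
# The kernel of the generalized Possio equation

The Hankel function enters only on the rotated right half-plane, `z = i w` with `Re w > 0`, where
`H₀⁽¹⁾(i w) = -(2 i / π) K₀(w)` and `K₀(w) = ∫₀^∞ exp (-w cosh t) dt` (`hankelZero_I_mul`). To get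
this from the power series, note that the integral and the series both solve `w (w f')' = w² f`.
Their difference and `w` times its derivative tend to `0` as `w → 0⁺`, so the Wronskian with `I₀`
vanishes, the difference is a multiple of `I₀` on the positive axis, and the multiple is `0`; the
identity theorem extends this to the half-plane. The limit at the origin needs the constant in
`K₀(r) = -log (r/2) - γ + o(1)`, which comes from `Γ'(1) = -γ` through the exponential integral
(`tendsto_macdonaldReal_add_log`).

All estimates then come from the integral. Writing `cosh t = sinh t + e⁻ᵗ` in `K₁ = -K₀'` shows
`|K₁(w) - 1/w| ≤ 2` on the whole half-plane (`norm_coshMoment_one_sub_inv_le`), hence `K₀ + log` is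
Lipschitz there and differs from `log 2 - γ` by at most `2 |w|`. Moreover `|K₀(w)| ≤ K₀(Re w)`,
which is integrable over the line.

With `b = 1 - M²`, `θ = 1/(a b)` and `d = x - ξ` one has `λ = -s/(U b)` and
`λ² b - s²/(a² b) = s²/U²`, so as `y → 0⁺` the bracket tends to
`(2i/π) (b/U · s θ sgn d · K₁(s θ |d|) + s/U² · K₀(s θ |d|) - s²/U³ · ∫ …)`.
The pole of `K₁` gives the Cauchy kernel, the logarithm of `K₀` gives `A = -(2i/π) s/U²`, and the
rest is `B`. In `B` the first term is `O(|s|)`, the second is `s` times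
`K₀(w) + log w - log (s θ) = O(|s|)`, and the integral over the wake is bounded uniformly in `x`,
`ξ` and `Re s ≥ σ₁`.
-/

noncomputable section

/-! ### Everywhere convergent power series -/

/-- The sum of the power series with coefficients `c`. -/
def seriesSum (c : ℕ → ℂ) (q : ℂ) : ℂ := ∑' k, c k * q ^ k

/-- The power series with coefficients `c` converges absolutely everywhere. -/
def EntireCoeff (c : ℕ → ℂ) : Prop := ∀ R : ℝ, Summable fun k => ‖c k‖ * R ^ k

namespace EntireCoeff

variable {c : ℕ → ℂ}

lemma summable (hc : EntireCoeff c) (q : ℂ) : Summable fun k => c k * q ^ k :=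
  Summable.of_norm (by simpa using hc ‖q‖)

lemma natCast_mul (hc : EntireCoeff c) : EntireCoeff fun k => (k : ℂ) * c k := by
  intro R
  refine Summable.of_norm_bounded (hc (2 * |R|)) fun k => ?_
  have h2 : (k : ℝ) ≤ 2 ^ k := by exact_mod_cast Nat.lt_two_pow_self.le
  rw [norm_mul, norm_norm, norm_pow, norm_mul, Complex.norm_natCast, mul_pow, Real.norm_eq_abs]
  calc (k : ℝ) * ‖c k‖ * |R| ^ k ≤ 2 ^ k * ‖c k‖ * |R| ^ k := by gcongr
    _ = ‖c k‖ * (2 ^ k * |R| ^ k) := by ring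

lemma shift (hc : EntireCoeff c) : EntireCoeff fun k => c (k + 1) := by
  intro R
  have h := (summable_nat_add_iff 1).2 (hc (|R| + 1))
  refine Summable.of_norm_bounded h fun k => ?_
  rw [norm_mul, norm_norm, norm_pow, Real.norm_eq_abs]
  gcongr
  calc |R| ^ k ≤ (|R| + 1) ^ k := by gcongr; linarith
    _ ≤ (|R| + 1) ^ (k + 1) := pow_le_pow_right₀ (by linarith [abs_nonneg R]) (Nat.le_succ k)

lemma deriv_coeff (hc : EntireCoeff c) : EntireCoeff fun k => ((k : ℂ) + 1) * c (k + 1) := by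
  simpa using hc.natCast_mul.shift

lemma hasDerivAt (hc : EntireCoeff c) (q : ℂ) :
    HasDerivAt (seriesSum c) (seriesSum (fun k => ((k : ℂ) + 1) * c (k + 1)) q) q := by
  have hs : Summable fun k : ℕ => c k * ((k : ℂ) * q ^ (k - 1)) := by
    rw [← summable_nat_add_iff 1]
    refine (hc.deriv_coeff.summable q).congr fun k => ?_
    simp only [Nat.add_sub_cancel]
    push_cast; ring
  have h := hasDerivAt_tsum_of_isPreconnected (t := Metric.ball 0 (‖q‖ + 1))
    (g := fun (k : ℕ) y => c k * y ^ k) (g' := fun (k : ℕ) y => c k * ((k : ℂ) * y ^ (k - 1)))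
    (u := fun k : ℕ => ‖(k : ℂ) * c k‖ * (‖q‖ + 1) ^ k) (y := q) (y₀ := q)
    (hc.natCast_mul _) Metric.isOpen_ball (convex_ball _ _).isPreconnected
    (fun k y _ => (hasDerivAt_pow k y).const_mul _) ?_ (by simp) (hc.summable q) (by simp)
  · refine h.congr_deriv ?_
    rw [hs.tsum_eq_zero_add]
    simp only [seriesSum, Nat.cast_zero, zero_mul, mul_zero, zero_add, Nat.add_sub_cancel]
    refine tsum_congr fun k => ?_
    push_cast; ring
  · intro k y hy
    have hy' : ‖y‖ ≤ ‖q‖ + 1 := by simpa using (mem_ball_zero_iff.1 hy).le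
    rw [norm_mul, norm_mul, norm_mul, norm_pow]
    have : ‖y‖ ^ (k - 1) ≤ (‖q‖ + 1) ^ k :=
      (pow_le_pow_left₀ (norm_nonneg _) hy' _).trans
        (pow_le_pow_right₀ (by linarith [norm_nonneg q]) (Nat.sub_le k 1))
    calc ‖c k‖ * (‖(k : ℂ)‖ * ‖y‖ ^ (k - 1)) = ‖(k : ℂ)‖ * ‖c k‖ * ‖y‖ ^ (k - 1) := by ring
      _ ≤ _ := by gcongr

lemma seriesSum_natCast_mul (hc : EntireCoeff c) (q : ℂ) :
    seriesSum (fun k => (k : ℂ) * c k) q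
      = q * seriesSum (fun k => ((k : ℂ) + 1) * c (k + 1)) q := by
  unfold seriesSum
  rw [(hc.natCast_mul.summable q).tsum_eq_zero_add, ← tsum_mul_left]
  simp only [Nat.cast_zero, zero_mul, zero_add]
  refine tsum_congr fun k => ?_
  push_cast; ring

lemma of_le_inv_factorial (h : ∀ k, ‖c k‖ ≤ 1 / (k.factorial : ℝ)) : EntireCoeff c := by
  intro R
  refine Summable.of_norm_bounded (Real.summable_pow_div_factorial |R|) fun k => ?_
  rw [norm_mul, norm_norm, norm_pow, Real.norm_eq_abs]
  calc ‖c k‖ * |R| ^ k ≤ 1 / (k.factorial : ℝ) * |R| ^ k := by gcongr; exact h k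
    _ = _ := by ring

end EntireCoeff

lemma seriesSum_zero (c : ℕ → ℂ) : seriesSum c 0 = c 0 := by
  unfold seriesSum
  rw [tsum_eq_single 0 (fun k hk => by simp [hk])]
  simp

lemma seriesSum_add {c d : ℕ → ℂ} (hc : EntireCoeff c) (hd : EntireCoeff d) (q : ℂ) :
    seriesSum (fun k => c k + d k) q = seriesSum c q + seriesSum d q := by
  unfold seriesSum
  rw [← (hc.summable q).tsum_add (hd.summable q)]
  exact tsum_congr fun k => by ring

/-! ### The power series of the Bessel functions of order zero -/

/-- Coefficients of `I₀(w) = ∑ (w/2)^(2k) / (k!)²` in the variable `q = (w/2)²`. -/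
def besselCoeff (k : ℕ) : ℂ := 1 / ((k.factorial : ℂ) ^ 2)

/-- Coefficients of `∑ h_k (w/2)^(2k) / (k!)²` in the variable `q = (w/2)²`, where `h_k` is the
`k`-th harmonic number. -/
def harmonicCoeff (k : ℕ) : ℂ := ((harmonic k : ℚ) : ℂ) / ((k.factorial : ℂ) ^ 2)

lemma entireCoeff_bessel : EntireCoeff besselCoeff := by
  refine .of_le_inv_factorial fun k => ?_
  have h1 : (1 : ℝ) ≤ k.factorial := by exact_mod_cast k.factorial_pos
  rw [besselCoeff, norm_div, norm_pow, Complex.norm_natCast, norm_one]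
  gcongr
  nlinarith

lemma entireCoeff_harmonic : EntireCoeff harmonicCoeff := by
  refine .of_le_inv_factorial fun k => ?_
  have h0 : 0 ≤ harmonic k := Finset.sum_nonneg fun i _ => by positivity
  have h1 : harmonic k ≤ k := by
    have : harmonic k ≤ ∑ i ∈ Finset.range k, (1 : ℚ) := by
      refine Finset.sum_le_sum fun i _ => inv_le_one_of_one_le₀ ?_
      push_cast; linarith [(Nat.cast_nonneg i : (0 : ℚ) ≤ i)]
    simpa using this
  have h2 : ‖((harmonic k : ℚ) : ℂ)‖ ≤ k.factorial := by
    rw [show ((harmonic k : ℚ) : ℂ) = (((harmonic k : ℚ) : ℝ) : ℂ) by norm_cast,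
      Complex.norm_real, Real.norm_eq_abs, abs_of_nonneg (by exact_mod_cast h0)]
    have h3 : ((harmonic k : ℚ) : ℝ) ≤ k := by exact_mod_cast h1
    exact h3.trans (by exact_mod_cast k.self_le_factorial)
  have h4 : (0 : ℝ) < k.factorial := by exact_mod_cast k.factorial_pos
  rw [harmonicCoeff, norm_div, norm_pow, Complex.norm_natCast, div_le_div_iff₀ (by positivity) h4]
  nlinarith

lemma besselCoeff_succ (k : ℕ) :
    ((k : ℂ) + 1) * (((k + 1 : ℕ) : ℂ) * besselCoeff (k + 1)) = besselCoeff k := by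
  have : (k.factorial : ℂ) ≠ 0 := by exact_mod_cast k.factorial_ne_zero
  have : (k : ℂ) + 1 ≠ 0 := by exact_mod_cast k.succ_ne_zero
  simp only [besselCoeff, Nat.factorial_succ]
  push_cast
  field_simp

lemma harmonicCoeff_succ (k : ℕ) :
    ((k : ℂ) + 1) * (((k + 1 : ℕ) : ℂ) * harmonicCoeff (k + 1))
      = harmonicCoeff k + ((k : ℂ) + 1) * besselCoeff (k + 1) := by
  have : (k.factorial : ℂ) ≠ 0 := by exact_mod_cast k.factorial_ne_zero
  have : (k : ℂ) + 1 ≠ 0 := by exact_mod_cast k.succ_ne_zero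
  simp only [besselCoeff, harmonicCoeff, Nat.factorial_succ, harmonic_succ]
  push_cast
  field_simp

/-- `besselF (w²/4) = I₀(w)`. -/
def besselF : ℂ → ℂ := seriesSum besselCoeff

/-- The derivative of `besselF`. -/
def besselF' : ℂ → ℂ := seriesSum fun k => ((k : ℂ) + 1) * besselCoeff (k + 1)

/-- The entire part `∑ h_k q^k / (k!)²` of `K₀`, in the variable `q = w²/4`. -/
def besselS : ℂ → ℂ := seriesSum harmonicCoeff

/-- The derivative of `besselS`. -/
def besselS' : ℂ → ℂ := seriesSum fun k => ((k : ℂ) + 1) * harmonicCoeff (k + 1)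

lemma hasDerivAt_besselF (q : ℂ) : HasDerivAt besselF (besselF' q) q :=
  entireCoeff_bessel.hasDerivAt q

lemma hasDerivAt_besselS (q : ℂ) : HasDerivAt besselS (besselS' q) q :=
  entireCoeff_harmonic.hasDerivAt q

/-- The modified Bessel equation `(q F')' = F`. -/
lemma hasDerivAt_mul_besselF' (q : ℂ) : HasDerivAt (fun q => q * besselF' q) (besselF q) q := by
  have h := entireCoeff_bessel.natCast_mul.hasDerivAt q
  simp only [besselCoeff_succ] at h
  rwa [funext entireCoeff_bessel.seriesSum_natCast_mul] at h

/-- The inhomogeneous modified Bessel equation `(q S')' = S + F'`. -/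
lemma hasDerivAt_mul_besselS' (q : ℂ) :
    HasDerivAt (fun q => q * besselS' q) (besselS q + besselF' q) q := by
  have h := entireCoeff_harmonic.natCast_mul.hasDerivAt q
  simp only [harmonicCoeff_succ] at h
  rw [funext entireCoeff_harmonic.seriesSum_natCast_mul,
    seriesSum_add entireCoeff_harmonic entireCoeff_bessel.deriv_coeff] at h
  exact h

lemma besselF_zero : besselF 0 = 1 := by simp [besselF, seriesSum_zero, besselCoeff]

lemma besselS_zero : besselS 0 = 0 := by simp [besselS, seriesSum_zero, harmonicCoeff]

lemma besselF_ofReal_ne_zero {r : ℝ} (hr : 0 ≤ r) : besselF r ≠ 0 := by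
  have hf : ∀ k : ℕ, besselCoeff k * (r : ℂ) ^ k = ((1 / (k.factorial : ℝ) ^ 2 * r ^ k : ℝ) : ℂ) :=
    fun k => by simp [besselCoeff]
  have hs : Summable fun k : ℕ => 1 / (k.factorial : ℝ) ^ 2 * r ^ k := by
    have := entireCoeff_bessel r
    refine this.congr fun k => ?_
    simp [besselCoeff]
  have hpos : 0 < ∑' k : ℕ, 1 / (k.factorial : ℝ) ^ 2 * r ^ k :=
    hs.tsum_pos (fun k => by positivity) 0 (by simp)
  rw [besselF, seriesSum, tsum_congr hf, ← Complex.ofReal_tsum]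
  exact_mod_cast hpos.ne'

lemma besselJZero_eq (z : ℂ) : besselJZero z = besselF (-(z / 2) ^ 2) := by
  unfold besselJZero besselF seriesSum besselCoeff
  refine tsum_congr fun k => ?_
  rw [neg_pow (_ ^ 2), ← pow_mul]
  ring

lemma besselYZero_eq (z : ℂ) : besselYZero z =
    (2 / (Real.pi : ℂ)) *
      (Complex.log (z / 2) + (Real.eulerMascheroniConstant : ℂ)) * besselF (-(z / 2) ^ 2)
    - (2 / (Real.pi : ℂ)) * besselS (-(z / 2) ^ 2) := by
  rw [besselYZero, besselJZero_eq]
  congr 2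
  unfold besselS seriesSum harmonicCoeff
  refine tsum_congr fun k => ?_
  rw [neg_pow (_ ^ 2), ← pow_mul]
  ring

/-- The function `-(log (w/2) + γ) I₀(w) + ∑ h_k (w/2)^(2k) / (k!)²`, the series form of the
Macdonald function `K₀`. -/
def macdonaldSeries (w : ℂ) : ℂ :=
  -(Complex.log w - Real.log 2 + Real.eulerMascheroniConstant) * besselF (w ^ 2 / 4)
    + besselS (w ^ 2 / 4)

/-- `w` times the derivative of `macdonaldSeries`. -/
def macdonaldSeriesD (w : ℂ) : ℂ :=
  -besselF (w ^ 2 / 4)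
    - (Complex.log w - Real.log 2 + Real.eulerMascheroniConstant)
      * (w ^ 2 / 2 * besselF' (w ^ 2 / 4))
    + w ^ 2 / 2 * besselS' (w ^ 2 / 4)

lemma hasDerivAt_sq_div_four (w : ℂ) : HasDerivAt (fun w : ℂ => w ^ 2 / 4) (w / 2) w := by
  have := (hasDerivAt_pow 2 w).div_const 4
  refine this.congr_deriv ?_
  push_cast; ring

lemma hasDerivAt_log_term {w : ℂ} (hw : w ∈ Complex.slitPlane) :
    HasDerivAt (fun w => Complex.log w - Real.log 2 + Real.eulerMascheroniConstant) w⁻¹ w :=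
  ((Complex.hasDerivAt_log hw).sub_const _).add_const _

lemma hasDerivAt_macdonaldSeries {w : ℂ} (hw : w ∈ Complex.slitPlane) :
    HasDerivAt macdonaldSeries (macdonaldSeriesD w / w) w := by
  have h0 : w ≠ 0 := Complex.slitPlane_ne_zero hw
  have hF := (hasDerivAt_besselF (w ^ 2 / 4)).comp w (hasDerivAt_sq_div_four w)
  have hS := (hasDerivAt_besselS (w ^ 2 / 4)).comp w (hasDerivAt_sq_div_four w)
  refine (((hasDerivAt_log_term hw).neg.mul hF).add hS).congr_deriv ?_
  simp only [macdonaldSeriesD, Function.comp_apply, Pi.neg_apply]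
  field_simp
  ring

lemma hasDerivAt_macdonaldSeriesD {w : ℂ} (hw : w ∈ Complex.slitPlane) :
    HasDerivAt macdonaldSeriesD (w * macdonaldSeries w) w := by
  have h0 : w ≠ 0 := Complex.slitPlane_ne_zero hw
  have hq := hasDerivAt_sq_div_four w
  have hF := (hasDerivAt_besselF (w ^ 2 / 4)).comp w hq
  have hE := ((hasDerivAt_mul_besselF' (w ^ 2 / 4)).comp w hq).const_mul 2
  have hT := ((hasDerivAt_mul_besselS' (w ^ 2 / 4)).comp w hq).const_mul 2
  have h := ((hF.neg).sub ((hasDerivAt_log_term hw).mul hE)).add hT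
  refine (h.congr_of_eventuallyEq (.of_forall fun v => ?_)).congr_deriv ?_
  · simp only [macdonaldSeriesD, Function.comp_apply, Pi.neg_apply, Pi.add_apply, Pi.sub_apply,
      Pi.mul_apply]
    ring
  · simp only [macdonaldSeries, Function.comp_apply]
    field_simp
    ring

/-- The logarithm of the argument of the Hankel function, rotated into the right half-plane. -/
lemma log_I_mul_div_two {w : ℂ} (hw : 0 < w.re) :
    Complex.log (Complex.I * w / 2) = Complex.log w - Real.log 2 + Complex.I * (Real.pi / 2) := by
  have h0 : w ≠ 0 := by rintro rfl; simp at hw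
  have harg : w.arg ∈ Ioo (-(Real.pi / 2)) (Real.pi / 2) := by
    have := Complex.abs_arg_lt_pi_div_two_iff.2 (Or.inl hw)
    exact abs_lt.1 this
  have h1 : Complex.log (Complex.I * w) = Complex.log Complex.I + Complex.log w := by
    rw [Complex.log_mul_eq_add_log_iff Complex.I_ne_zero h0, Complex.arg_I]
    exact ⟨by linarith [harg.1, Real.pi_pos], by linarith [harg.2]⟩
  rw [show Complex.I * w / 2 = (((1 / 2 : ℝ)) : ℂ) * (Complex.I * w) by push_cast; ring,
    Complex.log_ofReal_mul (by norm_num) (mul_ne_zero Complex.I_ne_zero h0), h1, Complex.log_I]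
  rw [one_div, Real.log_inv]
  push_cast
  ring

/-- On the rotated half-plane the Hankel function is a multiple of the series form of `K₀`. -/
lemma hankelZero_I_mul_eq_series {w : ℂ} (hw : 0 < w.re) :
    hankelZero (Complex.I * w) = -(2 * Complex.I / Real.pi) * macdonaldSeries w := by
  have hpi : (Real.pi : ℂ) ≠ 0 := by exact_mod_cast Real.pi_ne_zero
  have hq : -(Complex.I * w / 2) ^ 2 = w ^ 2 / 4 := by
    rw [div_pow, mul_pow, Complex.I_sq]; ring
  rw [hankelZero, besselJZero_eq, besselYZero_eq, hq, log_I_mul_div_two hw, macdonaldSeries]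
  field_simp
  linear_combination (Real.pi : ℂ) * besselF (w ^ 2 / 4) * Complex.I_sq

/-! ### The Schläfli integrals -/

/-- The integral `∫₀^∞ (cosh t)ⁿ exp (-w cosh t) dt`, convergent for `Re w > 0`. It is
`(-1)ⁿ` times the `n`-th derivative of the Macdonald function `K₀`. -/
def coshMoment (n : ℕ) (w : ℂ) : ℂ :=
  ∫ t in Ioi (0 : ℝ), (Real.cosh t : ℂ) ^ n * Complex.exp (-(w * Real.cosh t))

/-- The Macdonald function `K₀` on the positive reals. -/
def macdonaldReal (r : ℝ) : ℝ := ∫ t in Ioi (0 : ℝ), Real.exp (-(r * Real.cosh t))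

lemma exp_le_two_mul_cosh (t : ℝ) : Real.exp t ≤ 2 * Real.cosh t := by
  rw [Real.cosh_eq]; linarith [Real.exp_pos (-t)]

lemma inv_cosh_le (t : ℝ) : (Real.cosh t)⁻¹ ≤ 2 * Real.exp (-t) := by
  rw [Real.exp_neg, ← div_eq_mul_inv, inv_eq_one_div, div_le_div_iff₀ (Real.cosh_pos t)
    (Real.exp_pos t)]
  linarith [exp_le_two_mul_cosh t]

lemma pow_mul_exp_neg_le {y : ℝ} (hy : 0 < y) (n : ℕ) :
    y ^ n * Real.exp (-y) ≤ n.factorial := by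
  have h := Real.pow_div_factorial_le_exp y hy.le n
  rw [div_le_iff₀ (by exact_mod_cast n.factorial_pos)] at h
  rw [Real.exp_neg, ← div_eq_mul_inv, div_le_iff₀ (Real.exp_pos y)]
  linarith

lemma cosh_pow_mul_exp_le (n : ℕ) {r : ℝ} (hr : 0 < r) (t : ℝ) :
    Real.cosh t ^ n * Real.exp (-(r * Real.cosh t))
      ≤ 2 * ((n + 1).factorial / r ^ (n + 1)) * Real.exp (-t) := by
  have hc := Real.cosh_pos t
  have h := pow_mul_exp_neg_le (mul_pos hr hc) (n + 1)
  have h1 : Real.cosh t ^ n * Real.exp (-(r * Real.cosh t))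
      = ((r * Real.cosh t) ^ (n + 1) * Real.exp (-(r * Real.cosh t))) / r ^ (n + 1)
        * (Real.cosh t)⁻¹ := by
    rw [mul_pow, pow_succ (Real.cosh t)]
    field_simp
  rw [h1]
  calc _ ≤ ((n + 1).factorial : ℝ) / r ^ (n + 1) * (2 * Real.exp (-t)) := by
        gcongr
        exact inv_cosh_le t
    _ = _ := by ring

lemma norm_cosh_pow_mul_exp (n : ℕ) (w : ℂ) (t : ℝ) :
    ‖(Real.cosh t : ℂ) ^ n * Complex.exp (-(w * Real.cosh t))‖
      = Real.cosh t ^ n * Real.exp (-(w.re * Real.cosh t)) := by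
  rw [norm_mul, norm_pow, Complex.norm_real, Complex.norm_exp, Real.norm_eq_abs,
    abs_of_pos (Real.cosh_pos t)]
  simp

lemma continuous_cosh_pow_mul_exp (n : ℕ) (w : ℂ) :
    Continuous fun t : ℝ => (Real.cosh t : ℂ) ^ n * Complex.exp (-(w * Real.cosh t)) := by
  fun_prop

lemma integrableOn_cosh_moment (n : ℕ) {w : ℂ} (hw : 0 < w.re) :
    IntegrableOn (fun t : ℝ => (Real.cosh t : ℂ) ^ n * Complex.exp (-(w * Real.cosh t)))
      (Ioi 0) :=
  ((integrableOn_exp_neg_Ioi 0).const_mul (2 * ((n + 1).factorial / w.re ^ (n + 1)))).mono'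
    (continuous_cosh_pow_mul_exp n w).aestronglyMeasurable
    (.of_forall fun t => by
      rw [norm_cosh_pow_mul_exp]; exact cosh_pow_mul_exp_le n hw t)

lemma hasDerivAt_coshMoment (n : ℕ) {w : ℂ} (hw : 0 < w.re) :
    HasDerivAt (coshMoment n) (-coshMoment (n + 1) w) w := by
  have hr : 0 < w.re / 2 := by linarith
  have h := (hasDerivAt_integral_of_dominated_loc_of_deriv_le (𝕜 := ℂ)
    (μ := volume.restrict (Ioi (0 : ℝ)))
    (F := fun w t => (Real.cosh t : ℂ) ^ n * Complex.exp (-(w * Real.cosh t)))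
    (F' := fun w t => -((Real.cosh t : ℂ) ^ (n + 1) * Complex.exp (-(w * Real.cosh t))))
    (bound := fun t => 2 * ((n + 2).factorial / (w.re / 2) ^ (n + 2)) * Real.exp (-t))
    (s := Metric.ball w (w.re / 2)) (Metric.ball_mem_nhds _ hr)
    (.of_forall fun v => (continuous_cosh_pow_mul_exp n v).aestronglyMeasurable)
    (integrableOn_cosh_moment n hw)
    (continuous_cosh_pow_mul_exp (n + 1) w).neg.aestronglyMeasurable
    (.of_forall fun t v hv => ?_)
    ((integrableOn_exp_neg_Ioi 0).const_mul _)
    (.of_forall fun t v _ => ?_)).2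
  · rw [integral_neg] at h
    exact h
  · have hv' : w.re / 2 ≤ v.re := by
      have h1 : |(v - w).re| < w.re / 2 :=
        (Complex.abs_re_le_norm _).trans_lt (by simpa [dist_eq_norm] using hv)
      rw [Complex.sub_re] at h1
      linarith [(abs_lt.1 h1).1]
    rw [norm_neg, norm_cosh_pow_mul_exp]
    refine le_trans ?_ (cosh_pow_mul_exp_le (n + 1) hr t)
    have := Real.cosh_pos t
    gcongr
  · have h1 : HasDerivAt (fun v : ℂ => -(v * Real.cosh t)) (-(Real.cosh t : ℂ)) v := by
      simpa only [one_mul, id] using ((hasDerivAt_id v).mul_const (Real.cosh t : ℂ)).fun_neg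
    refine (h1.cexp.const_mul _).congr_deriv ?_
    ring

lemma isOpen_re_pos : IsOpen {w : ℂ | 0 < w.re} := isOpen_lt continuous_const Complex.continuous_re

lemma convex_re_pos : Convex ℝ {w : ℂ | 0 < w.re} := convex_halfSpace_re_gt 0

lemma continuousAt_coshMoment (n : ℕ) {w : ℂ} (hw : 0 < w.re) : ContinuousAt (coshMoment n) w :=
  (hasDerivAt_coshMoment n hw).continuousAt

lemma stronglyMeasurable_coshMoment (n : ℕ) : StronglyMeasurable (coshMoment n) := by
  refine StronglyMeasurable.integral_prod_right
    (f := fun w t => (Real.cosh t : ℂ) ^ n * Complex.exp (-(w * Real.cosh t))) ?_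
  have : Continuous (Function.uncurry fun (w : ℂ) (t : ℝ) =>
      (Real.cosh t : ℂ) ^ n * Complex.exp (-(w * Real.cosh t))) := by
    unfold Function.uncurry
    fun_prop
  exact this.stronglyMeasurable

/-! ### Real bounds for `K₀` -/

lemma integrableOn_exp_neg_mul_cosh {r : ℝ} (hr : 0 < r) :
    IntegrableOn (fun t : ℝ => Real.exp (-(r * Real.cosh t))) (Ioi 0) := by
  refine ((integrableOn_exp_neg_Ioi 0).const_mul (2 * ((0 + 1).factorial / r ^ (0 + 1)))).mono'
    (by fun_prop) (.of_forall fun t => ?_)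
  rw [Real.norm_eq_abs, abs_of_pos (Real.exp_pos _)]
  simpa using cosh_pow_mul_exp_le 0 hr t

lemma coshMoment_zero_ofReal (r : ℝ) : coshMoment 0 r = macdonaldReal r := by
  rw [coshMoment, macdonaldReal, ← integral_complex_ofReal]
  refine integral_congr_ae (.of_forall fun t => ?_)
  push_cast
  simp

lemma norm_coshMoment_zero_le {w : ℂ} {r : ℝ} (hr : 0 < r) (hw : r ≤ w.re) :
    ‖coshMoment 0 w‖ ≤ macdonaldReal r := by
  refine norm_integral_le_of_norm_le (integrableOn_exp_neg_mul_cosh hr) (.of_forall fun t => ?_)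
  rw [norm_cosh_pow_mul_exp, pow_zero, one_mul]
  have := Real.cosh_pos t
  gcongr

lemma macdonaldReal_nonneg (r : ℝ) : 0 ≤ macdonaldReal r :=
  integral_nonneg fun _ => (Real.exp_pos _).le

lemma one_add_sq_div_two_le_cosh (t : ℝ) : 1 + t ^ 2 / 2 ≤ Real.cosh t := by
  have h1 : Real.cosh t = 1 + 2 * Real.sinh (t / 2) ^ 2 := by
    rw [show t = 2 * (t / 2) by ring, Real.cosh_two_mul, Real.cosh_sq]
    ring_nf
  have h2 : |t / 2| ≤ |Real.sinh (t / 2)| := by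
    rcases le_total 0 (t / 2) with h | h
    · rw [abs_of_nonneg h]; exact (Real.self_le_sinh_iff.2 h).trans (le_abs_self _)
    · rw [abs_of_nonpos h, abs_of_nonpos (Real.sinh_nonpos_iff.2 h)]
      linarith [Real.sinh_le_self_iff.2 h]
  have h3 := sq_le_sq.2 h2
  rw [h1]; nlinarith

lemma macdonaldReal_le {r : ℝ} (hr : 0 < r) :
    macdonaldReal r ≤ Real.sqrt (Real.pi * 2) / 2 * (Real.exp (-r) * r ^ (1 / 2 - 1 : ℝ)) := by
  have hr2 : 0 < r / 2 := by linarith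
  have h1 : macdonaldReal r ≤ ∫ t in Ioi (0 : ℝ), Real.exp (-r) * Real.exp (-(r / 2) * t ^ 2) := by
    refine setIntegral_mono (integrableOn_exp_neg_mul_cosh hr)
      ((integrable_exp_neg_mul_sq hr2).integrableOn.const_mul _) fun t => ?_
    change _ ≤ Real.exp (-r) * Real.exp (-(r / 2) * t ^ 2)
    rw [← Real.exp_add]
    refine Real.exp_le_exp.2 ?_
    nlinarith [one_add_sq_div_two_le_cosh t]
  refine h1.trans_eq ?_
  rw [integral_const_mul, integral_gaussian_Ioi, show Real.pi / (r / 2) = Real.pi * 2 / r by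
    field_simp, Real.sqrt_div' _ hr.le, Real.sqrt_eq_rpow r,
    show (1 / 2 - 1 : ℝ) = -(1 / 2) by norm_num, Real.rpow_neg hr.le]
  ring

lemma integrable_macdonaldReal_abs {σ : ℝ} (hσ : 0 < σ) :
    Integrable fun v : ℝ => macdonaldReal (σ * |v|) := by
  have hmeas : AEStronglyMeasurable (fun v : ℝ => macdonaldReal (σ * |v|)) := by
    have h : StronglyMeasurable fun v : ℝ => (coshMoment 0 ((σ * |v| : ℝ) : ℂ)).re :=
      Complex.continuous_re.comp_stronglyMeasurable
        ((stronglyMeasurable_coshMoment 0).comp_measurable (by fun_prop))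
    simp_rw [coshMoment_zero_ofReal, Complex.ofReal_re] at h
    exact h.aestronglyMeasurable
  have hpos : IntegrableOn (fun v : ℝ => macdonaldReal (σ * |v|)) (Ioi 0) := by
    have hg := (integrableOn_Ioi_comp_mul_left_iff
      (fun x : ℝ => Real.exp (-x) * x ^ (1 / 2 - 1 : ℝ)) 0 hσ).2
      (by simpa using Real.GammaIntegral_convergent (s := 1 / 2) (by norm_num))
    refine (hg.const_mul (Real.sqrt (Real.pi * 2) / 2)).mono' hmeas.restrict ?_
    refine (ae_restrict_mem measurableSet_Ioi).mono fun v hv => ?_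
    have hv : (0 : ℝ) < v := hv
    rw [Real.norm_eq_abs, abs_of_nonneg (macdonaldReal_nonneg _), abs_of_pos hv]
    exact macdonaldReal_le (mul_pos hσ hv)
  have hneg : IntegrableOn (fun v : ℝ => macdonaldReal (σ * |v|)) (Iio 0) := by
    have h := IntegrableOn.comp_neg_Iio (c := 0) (f := fun v : ℝ => macdonaldReal (σ * |v|))
      (by rwa [neg_zero])
    simpa only [abs_neg] using h
  rw [← integrableOn_univ, ← Iio_union_Ici (a := (0 : ℝ))]
  exact hneg.union ((integrableOn_Ici_iff_integrableOn_Ioi).2 hpos)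

/-! ### The Macdonald functions `K₀` and `K₁` near the origin -/

lemma tendsto_exp_neg_mul_cosh {w : ℂ} (hw : 0 < w.re) (n : ℕ) :
    Tendsto (fun t : ℝ => (Real.cosh t : ℂ) ^ n * Complex.exp (-(w * Real.cosh t))) atTop
      (𝓝 0) := by
  have h : Tendsto (fun t : ℝ => 2 * ((n + 1).factorial / w.re ^ (n + 1)) * Real.exp (-t)) atTop
      (𝓝 0) := by
    simpa using (Real.tendsto_exp_neg_atTop_nhds_zero).const_mul
      (2 * (((n + 1).factorial : ℝ) / w.re ^ (n + 1)))
  refine squeeze_zero_norm (fun t => ?_) h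
  rw [norm_cosh_pow_mul_exp]
  exact cosh_pow_mul_exp_le n hw t

lemma hasDerivAt_exp_neg_mul_cosh (w : ℂ) (t : ℝ) :
    HasDerivAt (fun t : ℝ => Complex.exp (-(w * Real.cosh t)))
      (-(w * (Real.sinh t * Complex.exp (-(w * Real.cosh t))))) t := by
  have h := (((Real.hasDerivAt_cosh t).ofReal_comp.const_mul w).fun_neg).cexp
  refine h.congr_deriv ?_
  ring

lemma abs_sinh_le_cosh (t : ℝ) : |Real.sinh t| ≤ Real.cosh t := by
  rw [abs_le]
  constructor
  · rw [Real.sinh_eq, Real.cosh_eq]; linarith [Real.exp_pos t]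
  · exact (Real.sinh_lt_cosh t).le

lemma integrableOn_sinh_mul_exp {w : ℂ} (hw : 0 < w.re) :
    IntegrableOn (fun t : ℝ => (Real.sinh t : ℂ) * Complex.exp (-(w * Real.cosh t))) (Ioi 0) := by
  refine Integrable.mono (integrableOn_cosh_moment 1 hw)
    (Continuous.aestronglyMeasurable (by fun_prop)) (.of_forall fun t => ?_)
  rw [norm_mul, norm_mul, pow_one, Complex.norm_real, Complex.norm_real, Real.norm_eq_abs,
    Real.norm_eq_abs, abs_of_pos (Real.cosh_pos t)]
  gcongr
  exact abs_sinh_le_cosh t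

lemma integral_sinh_mul_exp {w : ℂ} (hw : 0 < w.re) :
    w * ∫ t in Ioi (0 : ℝ), (Real.sinh t : ℂ) * Complex.exp (-(w * Real.cosh t))
      = Complex.exp (-w) := by
  have h := integral_Ioi_of_hasDerivAt_of_tendsto' (a := (0 : ℝ))
    (fun t _ => hasDerivAt_exp_neg_mul_cosh w t)
    ((integrableOn_sinh_mul_exp hw).const_mul w).neg
    (by simpa using tendsto_exp_neg_mul_cosh hw 0)
  rw [integral_neg, integral_const_mul] at h
  simpa using h

/-- Recurrence `K₁ = w (K₀'' - K₀)`, the modified Bessel equation for the Schläfli integral. -/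
lemma coshMoment_one_eq {w : ℂ} (hw : 0 < w.re) :
    coshMoment 1 w = w * (coshMoment 2 w - coshMoment 0 w) := by
  have hd : ∀ t ∈ Ici (0 : ℝ), HasDerivAt
      (fun t : ℝ => (Real.sinh t : ℂ) * Complex.exp (-(w * Real.cosh t)))
      ((Real.cosh t : ℂ) ^ 1 * Complex.exp (-(w * Real.cosh t))
        - w * ((Real.cosh t : ℂ) ^ 2 * Complex.exp (-(w * Real.cosh t))
          - (Real.cosh t : ℂ) ^ 0 * Complex.exp (-(w * Real.cosh t)))) t := by
    intro t _
    refine ((Real.hasDerivAt_sinh t).ofReal_comp.mul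
      (hasDerivAt_exp_neg_mul_cosh w t)).congr_deriv ?_
    have h : (Real.cosh t : ℂ) ^ 2 = (Real.sinh t : ℂ) ^ 2 + 1 := by
      exact_mod_cast Real.cosh_sq t
    rw [h]
    ring
  have hint := (integrableOn_cosh_moment 1 hw).sub
    (((integrableOn_cosh_moment 2 hw).sub (integrableOn_cosh_moment 0 hw)).const_mul w)
  have hlim : Tendsto (fun t : ℝ => (Real.sinh t : ℂ) * Complex.exp (-(w * Real.cosh t))) atTop
      (𝓝 0) := by
    have h := (tendsto_exp_neg_mul_cosh hw 1).norm
    rw [norm_zero] at h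
    refine squeeze_zero_norm (fun t => ?_) h
    rw [norm_mul, norm_mul, pow_one, Complex.norm_real, Complex.norm_real, Real.norm_eq_abs,
      Real.norm_eq_abs, abs_of_pos (Real.cosh_pos t)]
    gcongr
    exact abs_sinh_le_cosh t
  have h := integral_Ioi_of_hasDerivAt_of_tendsto' hd hint hlim
  have h' : (∫ t in Ioi (0 : ℝ), ((Real.cosh t : ℂ) ^ 1 * Complex.exp (-(w * Real.cosh t))
        - w * ((Real.cosh t : ℂ) ^ 2 * Complex.exp (-(w * Real.cosh t))
          - (Real.cosh t : ℂ) ^ 0 * Complex.exp (-(w * Real.cosh t)))))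
      = coshMoment 1 w - w * (coshMoment 2 w - coshMoment 0 w) :=
    (integral_sub (integrableOn_cosh_moment 1 hw)
      (((integrableOn_cosh_moment 2 hw).sub (integrableOn_cosh_moment 0 hw)).const_mul w)).trans
      (congrArg _ ((integral_const_mul _ _).trans (congrArg _
        (integral_sub (integrableOn_cosh_moment 2 hw) (integrableOn_cosh_moment 0 hw)))))
  rw [h'] at h
  simp only [Real.sinh_zero, Complex.ofReal_zero, zero_mul, sub_zero] at h
  exact sub_eq_zero.1 h

lemma norm_exp_neg_sub_one_le {w : ℂ} (hw : 0 ≤ w.re) : ‖Complex.exp (-w) - 1‖ ≤ ‖w‖ := by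
  have h := (convex_halfSpace_re_ge 0).norm_image_sub_le_of_norm_hasDerivWithin_le (𝕜 := ℂ)
    (f := fun v : ℂ => Complex.exp (-v)) (f' := fun v => -Complex.exp (-v)) (C := 1)
    (x := (0 : ℂ)) (y := w) (fun v _ => ?_) (fun v hv => ?_) (by simp) hw
  · simpa using h
  · simpa using ((hasDerivAt_neg v).cexp).hasDerivWithinAt
  · rw [norm_neg, Complex.norm_exp, Complex.neg_re]
    exact Real.exp_le_one_iff.2 (by simpa using hv)

/-- `K₁(w) - 1/w` is bounded on the whole right half-plane, because `cosh t = sinh t + e⁻ᵗ`, the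
`sinh` part integrates to `e⁻ʷ/w`, and the rest is at most `∫ e⁻ᵗ`. -/
lemma norm_coshMoment_one_sub_inv_le {w : ℂ} (hw : 0 < w.re) : ‖coshMoment 1 w - w⁻¹‖ ≤ 2 := by
  have h0 : w ≠ 0 := by rintro rfl; simp at hw
  have hb : ∀ t : ℝ, ‖(Real.exp (-t) : ℂ) * Complex.exp (-(w * Real.cosh t))‖
      ≤ Real.exp (-t) := by
    intro t
    rw [norm_mul, Complex.norm_real, Real.norm_eq_abs, abs_of_pos (Real.exp_pos _),
      Complex.norm_exp]
    refine mul_le_of_le_one_right (Real.exp_pos _).le (Real.exp_le_one_iff.2 ?_)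
    have : 0 < w.re * Real.cosh t := mul_pos hw (Real.cosh_pos t)
    simp [-Complex.ofReal_cosh]
    linarith
  have hi : IntegrableOn (fun t : ℝ => (Real.exp (-t) : ℂ) * Complex.exp (-(w * Real.cosh t)))
      (Ioi 0) :=
    (integrableOn_exp_neg_Ioi 0).mono' (by fun_prop) (.of_forall hb)
  have hsplit : coshMoment 1 w = Complex.exp (-w) / w
      + ∫ t in Ioi (0 : ℝ), (Real.exp (-t) : ℂ) * Complex.exp (-(w * Real.cosh t)) := by
    rw [← integral_sinh_mul_exp hw, mul_div_cancel_left₀ _ h0,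
      ← integral_add (integrableOn_sinh_mul_exp hw) hi]
    refine integral_congr_ae (.of_forall fun t => ?_)
    change (Real.cosh t : ℂ) ^ 1 * _ = (Real.sinh t : ℂ) * _ + _ * _
    rw [← add_mul, pow_one, ← Complex.ofReal_add, ← Real.cosh_sub_sinh]
    congr 2
    ring
  have h1 : ‖∫ t in Ioi (0 : ℝ), (Real.exp (-t) : ℂ) * Complex.exp (-(w * Real.cosh t))‖ ≤ 1 := by
    refine (norm_integral_le_of_norm_le (integrableOn_exp_neg_Ioi 0) (.of_forall hb)).trans_eq ?_
    exact integral_exp_neg_Ioi_zero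
  have h2 : ‖(Complex.exp (-w) - 1) / w‖ ≤ 1 := by
    rw [norm_div, div_le_one (norm_pos_iff.2 h0)]
    exact norm_exp_neg_sub_one_le hw.le
  calc ‖coshMoment 1 w - w⁻¹‖ = ‖(Complex.exp (-w) - 1) / w
        + ∫ t in Ioi (0 : ℝ), (Real.exp (-t) : ℂ) * Complex.exp (-(w * Real.cosh t))‖ := by
        rw [hsplit]; congr 1; ring
    _ ≤ 1 + 1 := (norm_add_le _ _).trans (add_le_add h2 h1)
    _ = 2 := by norm_num

/-- Since its derivative `1/w - K₁(w)` is bounded, `K₀(w) + log w` is Lipschitz. -/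
lemma norm_coshMoment_zero_add_log_sub_le {v w : ℂ} (hv : 0 < v.re) (hw : 0 < w.re) :
    ‖(coshMoment 0 w + Complex.log w) - (coshMoment 0 v + Complex.log v)‖ ≤ 2 * ‖w - v‖ := by
  refine convex_re_pos.norm_image_sub_le_of_norm_hasDerivWithin_le (𝕜 := ℂ)
    (f := fun w => coshMoment 0 w + Complex.log w) (f' := fun w => -coshMoment 1 w + w⁻¹)
    (fun u hu => ?_) (fun u hu => ?_) hv hw
  · exact ((hasDerivAt_coshMoment 0 hu).add
      (Complex.hasDerivAt_log (Or.inl hu))).hasDerivWithinAt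
  · rw [← norm_neg, neg_add, neg_neg, ← sub_eq_add_neg]
    exact norm_coshMoment_one_sub_inv_le hu

/-! ### The constant in the logarithmic behaviour of `K₀` at the origin -/

lemma integral_log_mul_exp_neg :
    ∫ t in Ioi (0 : ℝ), Real.log t * Real.exp (-t) = -Real.eulerMascheroniConstant := by
  have h1 := Complex.hasDerivAt_GammaIntegral (s := 1) (by simp)
  have h2 : HasDerivAt Complex.GammaIntegral (-(Real.eulerMascheroniConstant : ℂ)) 1 := by
    refine Complex.hasDerivAt_Gamma_one.congr_of_eventuallyEq ?_
    filter_upwards [isOpen_re_pos.mem_nhds (show (1 : ℂ) ∈ {w : ℂ | 0 < w.re} by simp)] with s hs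
    exact (Complex.Gamma_eq_integral hs).symm
  have h3 := h1.unique h2
  have h4 : (∫ t : ℝ in Ioi 0, (t : ℂ) ^ ((1 : ℂ) - 1) * (Real.log t * Real.exp (-t)))
      = ((∫ t in Ioi (0 : ℝ), Real.log t * Real.exp (-t) : ℝ) : ℂ) := by
    rw [← integral_complex_ofReal]
    refine integral_congr_ae (.of_forall fun t => ?_)
    simp
  rw [h4] at h3
  exact_mod_cast h3

lemma integrableOn_log_mul_exp_neg :
    IntegrableOn (fun t : ℝ => Real.log t * Real.exp (-t)) (Ioi 0) := by
  -- a function that is not integrable would have integral `0`, but the integral is `-γ`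
  refine Integrable.of_integral_ne_zero ?_
  rw [integral_log_mul_exp_neg]
  linarith [Real.one_half_lt_eulerMascheroniConstant]

lemma mul_exp_pos {x : ℝ} (hx : 0 < x) (t : ℝ) : 0 < x * Real.exp t := mul_pos hx (Real.exp_pos t)

lemma exp_neg_mul_exp_le {x : ℝ} (hx : 0 < x) (t : ℝ) :
    Real.exp (-(x * Real.exp t)) ≤ 1 / x * Real.exp (-t) := by
  have h := pow_mul_exp_neg_le (mul_exp_pos hx t) 1
  have h1 : Real.exp (-(x * Real.exp t))
      = ((x * Real.exp t) ^ 1 * Real.exp (-(x * Real.exp t))) * (1 / x * Real.exp (-t)) := by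
    rw [Real.exp_neg t]
    field_simp
  rw [h1]
  exact mul_le_of_le_one_left (by positivity) (by simpa using h)

lemma mul_exp_neg_mul_exp_le {x : ℝ} (hx : 0 < x) (t : ℝ) :
    t * Real.exp (-(x * Real.exp t)) * (x * Real.exp t) ≤ 6 / x ^ 2 * Real.exp (-t) := by
  have h := pow_mul_exp_neg_le (mul_exp_pos hx t) 3
  have h0 : t ≤ Real.exp t := by linarith [Real.add_one_le_exp t]
  have h1 : Real.exp t * Real.exp (-(x * Real.exp t)) * (x * Real.exp t)
      = ((x * Real.exp t) ^ 3 * Real.exp (-(x * Real.exp t))) * (1 / x ^ 2 * Real.exp (-t)) := by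
    rw [Real.exp_neg t]
    field_simp
  calc _ ≤ Real.exp t * Real.exp (-(x * Real.exp t)) * (x * Real.exp t) := by gcongr
    _ ≤ 6 * (1 / x ^ 2 * Real.exp (-t)) := by
        rw [h1]; gcongr; simpa [Nat.factorial] using h
    _ = _ := by ring

/-- The exponential integral, after the substitution `τ = x eᵗ` and an integration by parts. -/
lemma integral_exp_neg_mul_exp {x : ℝ} (hx : 0 < x) :
    ∫ t in Ioi (0 : ℝ), Real.exp (-(x * Real.exp t))
      = (∫ u in Ioi x, Real.log u * Real.exp (-u)) - Real.log x * Real.exp (-x) := by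
  have hi1 : IntegrableOn (fun t : ℝ => Real.exp (-(x * Real.exp t))) (Ioi 0) := by
    refine ((integrableOn_exp_neg_Ioi 0).const_mul (1 / x)).mono' (by fun_prop)
      (.of_forall fun t => ?_)
    rw [Real.norm_eq_abs, abs_of_pos (Real.exp_pos _)]
    exact exp_neg_mul_exp_le hx t
  have hi2 : IntegrableOn (fun t : ℝ => t * Real.exp (-(x * Real.exp t)) * (x * Real.exp t))
      (Ioi 0) := by
    refine Integrable.mono' ((integrableOn_exp_neg_Ioi 0).const_mul (6 / x ^ 2)) (by fun_prop)
      ((ae_restrict_mem measurableSet_Ioi).mono fun t ht => ?_)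
    have ht : 0 < t := ht
    rw [Real.norm_eq_abs, abs_of_pos (by positivity)]
    exact mul_exp_neg_mul_exp_le hx t
  have hd : ∀ t ∈ Ici (0 : ℝ), HasDerivAt (fun t => t * Real.exp (-(x * Real.exp t)))
      (Real.exp (-(x * Real.exp t)) - t * Real.exp (-(x * Real.exp t)) * (x * Real.exp t)) t := by
    intro t _
    have h := (hasDerivAt_id t).mul (((Real.hasDerivAt_exp t).const_mul x).fun_neg).exp
    refine h.congr_deriv ?_
    simp only [id]
    ring
  have hlim : Tendsto (fun t => t * Real.exp (-(x * Real.exp t))) atTop (𝓝 0) := by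
    have h : Tendsto (fun t : ℝ => 1 / x * (t * Real.exp (-t))) atTop (𝓝 0) := by
      simpa using (Real.tendsto_pow_mul_exp_neg_atTop_nhds_zero 1).const_mul (1 / x)
    refine squeeze_zero' ?_ ?_ h
    · filter_upwards [eventually_ge_atTop 0] with t ht
      positivity
    · filter_upwards [eventually_ge_atTop 0] with t ht
      calc t * Real.exp (-(x * Real.exp t)) ≤ t * (1 / x * Real.exp (-t)) := by
            gcongr; exact exp_neg_mul_exp_le hx t
        _ = _ := by ring
  have hparts := integral_Ioi_of_hasDerivAt_of_tendsto' hd (hi1.sub hi2) hlim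
  have hparts' : (∫ t in Ioi (0 : ℝ), Real.exp (-(x * Real.exp t)))
      = ∫ t in Ioi (0 : ℝ), t * Real.exp (-(x * Real.exp t)) * (x * Real.exp t) := by
    have := (integral_sub hi1 hi2).symm.trans hparts
    simp only [zero_mul, sub_zero] at this
    linarith
  have hlogx : IntegrableOn (fun u => Real.log u * Real.exp (-u)) (Ioi x) :=
    integrableOn_log_mul_exp_neg.mono_set (Ioi_subset_Ioi hx.le)
  have hexpx : IntegrableOn (fun u => Real.log x * Real.exp (-u)) (Ioi x) :=
    (integrableOn_exp_neg_Ioi x).const_mul _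
  have hcomp : ∀ t : ℝ, Real.log (x * Real.exp t) - Real.log x = t := fun t => by
    rw [Real.log_mul hx.ne' (Real.exp_pos t).ne', Real.log_exp]; ring
  have hsub := integral_comp_mul_deriv_Ioi (f := fun t => x * Real.exp t)
    (f' := fun t => x * Real.exp t) (a := 0)
    (g := fun u => (Real.log u - Real.log x) * Real.exp (-u)) (by fun_prop)
    (Real.tendsto_exp_atTop.const_mul_atTop hx)
    (fun t _ => ((Real.hasDerivAt_exp t).const_mul x).hasDerivWithinAt) ?_ ?_ ?_
  · simp only [Function.comp_def, hcomp, Real.exp_zero, mul_one] at hsub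
    rw [hparts', hsub]
    simp_rw [sub_mul]
    rw [integral_sub hlogx hexpx, integral_const_mul, integral_exp_neg_Ioi]
  · refine ContinuousOn.mul (ContinuousOn.sub (Real.continuousOn_log.mono ?_) continuousOn_const)
      (by fun_prop)
    rintro _ ⟨t, -, rfl⟩
    exact (mul_exp_pos hx t).ne'
  · have h := (hlogx.sub hexpx)
    rw [← integrableOn_Ici_iff_integrableOn_Ioi] at h
    refine (h.congr_fun (fun u _ => ?_) measurableSet_Ici).mono_set ?_
    · simp only [Pi.sub_apply]; ring
    · rintro _ ⟨t, ht, rfl⟩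
      have := Real.one_le_exp (show (0 : ℝ) ≤ t from ht)
      exact le_mul_of_one_le_right hx.le this
  · simp only [Function.comp_def, hcomp]
    exact (integrableOn_Ici_iff_integrableOn_Ioi).2 hi2

lemma tendsto_mul_log_nhdsGT : Tendsto (fun r : ℝ => r * Real.log r) (𝓝[>] 0) (𝓝 0) := by
  refine (tendsto_log_mul_rpow_nhdsGT_zero zero_lt_one).congr fun r => ?_
  rw [Real.rpow_one, mul_comm]

lemma tendsto_integral_exp_neg_mul_exp_add_log :
    Tendsto (fun x => (∫ t in Ioi (0 : ℝ), Real.exp (-(x * Real.exp t))) + Real.log x) (𝓝[>] 0)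
      (𝓝 (-Real.eulerMascheroniConstant)) := by
  have h1 : Tendsto (fun x => ∫ u in Ioi x, Real.log u * Real.exp (-u)) (𝓝[>] (0 : ℝ))
      (𝓝 (-Real.eulerMascheroniConstant)) := by
    rw [← integral_log_mul_exp_neg]
    have h : Tendsto (fun x => ∫ u in Ioi (0 : ℝ),
        (Ioi x).indicator (fun u => Real.log u * Real.exp (-u)) u) (𝓝[>] (0 : ℝ))
        (𝓝 (∫ u in Ioi (0 : ℝ), Real.log u * Real.exp (-u))) := by
      refine tendsto_integral_filter_of_dominated_convergence
        (fun u => ‖Real.log u * Real.exp (-u)‖) ?_ ?_ integrableOn_log_mul_exp_neg.norm ?_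
      · exact .of_forall fun x =>
          integrableOn_log_mul_exp_neg.aestronglyMeasurable.indicator measurableSet_Ioi
      · exact .of_forall fun x => .of_forall fun u => norm_indicator_le_norm_self _ _
      · refine (ae_restrict_mem measurableSet_Ioi).mono fun u hu => ?_
        refine tendsto_const_nhds.congr' ?_
        filter_upwards [nhdsWithin_le_nhds (Iio_mem_nhds (show (0 : ℝ) < u from hu))] with x hx
        rw [indicator_of_mem (show u ∈ Ioi x from hx)]
    refine h.congr' ?_
    filter_upwards [self_mem_nhdsWithin] with x hx
    rw [setIntegral_indicator measurableSet_Ioi, inter_eq_self_of_subset_right]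
    exact Ioi_subset_Ioi (le_of_lt hx)
  have h2 : Tendsto (fun x => Real.log x * (1 - Real.exp (-x))) (𝓝[>] (0 : ℝ)) (𝓝 0) := by
    refine squeeze_zero_norm' ?_ (tendsto_mul_log_nhdsGT.norm.trans_eq (by simp))
    filter_upwards [self_mem_nhdsWithin] with x hx
    have hx : 0 < x := hx
    have h3 : 0 ≤ 1 - Real.exp (-x) := by
      linarith [Real.exp_le_one_iff.2 (by linarith : -x ≤ 0)]
    have h4 : 1 - Real.exp (-x) ≤ x := by linarith [Real.add_one_le_exp (-x)]
    rw [norm_mul, norm_mul, mul_comm, Real.norm_of_nonneg h3, Real.norm_of_nonneg hx.le]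
    gcongr
  have h := h1.add h2
  rw [add_zero] at h
  refine h.congr' ?_
  filter_upwards [self_mem_nhdsWithin] with x hx
  rw [integral_exp_neg_mul_exp hx]
  ring

/-- `K₀(r) + log (r/2) → -γ`: replacing `cosh t` by `eᵗ/2` in the Schläfli integral changes it by
at most `r/2`, and turns it into an exponential integral. -/
lemma tendsto_macdonaldReal_add_log :
    Tendsto (fun r => macdonaldReal r + Real.log r) (𝓝[>] 0)
      (𝓝 (Real.log 2 - Real.eulerMascheroniConstant)) := by
  have hhalf : Tendsto (fun r : ℝ => r / 2) (𝓝[>] 0) (𝓝[>] 0) := by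
    refine tendsto_nhdsWithin_iff.2 ⟨?_, ?_⟩
    · exact (Continuous.tendsto' (by fun_prop) 0 0 (by simp)).mono_left nhdsWithin_le_nhds
    · filter_upwards [self_mem_nhdsWithin] with r hr
      exact half_pos (show (0 : ℝ) < r from hr)
  have h1 := tendsto_integral_exp_neg_mul_exp_add_log.comp hhalf
  have h2 : Tendsto (fun r => macdonaldReal r
      - ∫ t in Ioi (0 : ℝ), Real.exp (-(r / 2 * Real.exp t))) (𝓝[>] 0) (𝓝 0) := by
    refine squeeze_zero_norm' ?_ (hhalf.mono_right nhdsWithin_le_nhds)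
    filter_upwards [self_mem_nhdsWithin] with r hr
    have hr : 0 < r := hr
    have hi : IntegrableOn (fun t : ℝ => Real.exp (-(r / 2 * Real.exp t))) (Ioi 0) := by
      refine ((integrableOn_exp_neg_Ioi 0).const_mul (1 / (r / 2))).mono' (by fun_prop)
        (.of_forall fun t => ?_)
      rw [Real.norm_eq_abs, abs_of_pos (Real.exp_pos _)]
      exact exp_neg_mul_exp_le (half_pos hr) t
    rw [macdonaldReal, ← integral_sub (integrableOn_exp_neg_mul_cosh hr) hi]
    have hb : ∀ t : ℝ, ‖Real.exp (-(r * Real.cosh t)) - Real.exp (-(r / 2 * Real.exp t))‖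
        ≤ r / 2 * Real.exp (-t) := by
      intro t
      have e1 : Real.exp (-(r * Real.cosh t))
          = Real.exp (-(r / 2 * Real.exp t)) * Real.exp (-(r / 2 * Real.exp (-t))) := by
        rw [← Real.exp_add, Real.cosh_eq]; ring_nf
      have e2 := Real.add_one_le_exp (-(r / 2 * Real.exp (-t)))
      have e3 : Real.exp (-(r / 2 * Real.exp (-t))) ≤ 1 :=
        Real.exp_le_one_iff.2 (neg_nonpos.2 (by positivity))
      have e4 : Real.exp (-(r / 2 * Real.exp t)) ≤ 1 :=
        Real.exp_le_one_iff.2 (neg_nonpos.2 (by positivity))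
      have e5 := Real.exp_pos (-(r / 2 * Real.exp t))
      rw [e1, norm_sub_rev, Real.norm_of_nonneg (by nlinarith)]
      nlinarith
    refine (norm_integral_le_of_norm_le ((integrableOn_exp_neg_Ioi 0).const_mul (r / 2))
      (.of_forall hb)).trans_eq ?_
    rw [integral_const_mul, integral_exp_neg_Ioi_zero, mul_one]
  have h := (h2.add h1).add_const (Real.log 2)
  rw [show (0 : ℝ) + -Real.eulerMascheroniConstant + Real.log 2
    = Real.log 2 - Real.eulerMascheroniConstant by ring] at h
  refine h.congr' ?_
  filter_upwards [self_mem_nhdsWithin] with r hr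
  simp only [Function.comp_apply]
  rw [Real.log_div (ne_of_gt hr) two_ne_zero]
  ring

lemma tendsto_coshMoment_zero_add_log :
    Tendsto (fun r : ℝ => coshMoment 0 r + Complex.log r) (𝓝[>] 0)
      (𝓝 ((Real.log 2 - Real.eulerMascheroniConstant : ℝ) : ℂ)) := by
  refine ((Complex.continuous_ofReal.tendsto _).comp tendsto_macdonaldReal_add_log).congr' ?_
  filter_upwards [self_mem_nhdsWithin] with r hr
  rw [Function.comp_apply, coshMoment_zero_ofReal, Complex.ofReal_add,
    Complex.ofReal_log (le_of_lt hr)]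

/-- Uniform version on the right half-plane of `K₀(w) + log w → log 2 - γ`. -/
lemma norm_coshMoment_zero_add_log_sub_const_le {w : ℂ} (hw : 0 < w.re) :
    ‖coshMoment 0 w + Complex.log w - ((Real.log 2 - Real.eulerMascheroniConstant : ℝ) : ℂ)‖
      ≤ 2 * ‖w‖ := by
  have h1 := (tendsto_coshMoment_zero_add_log.const_sub (coshMoment 0 w + Complex.log w)).norm
  have h2 : Tendsto (fun r : ℝ => 2 * ‖w - r‖) (𝓝[>] 0) (𝓝 (2 * ‖w‖)) :=
    (Continuous.tendsto' (by fun_prop) 0 _ (by simp)).mono_left nhdsWithin_le_nhds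
  refine le_of_tendsto_of_tendsto h1 h2 ?_
  filter_upwards [self_mem_nhdsWithin] with r hr
  exact norm_coshMoment_zero_add_log_sub_le (by simpa using hr) hw

/-! ### The Schläfli integral for the Hankel function -/

lemma hasDerivAt_neg_mul_coshMoment_one {w : ℂ} (hw : 0 < w.re) :
    HasDerivAt (fun w => -(w * coshMoment 1 w)) (w * coshMoment 0 w) w := by
  refine ((hasDerivAt_id w).mul (hasDerivAt_coshMoment 1 hw)).fun_neg.congr_deriv ?_
  simp only [id]
  linear_combination -coshMoment_one_eq hw

/-- `I₀(w)`, as an entire function. -/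
def besselI (w : ℂ) : ℂ := besselF (w ^ 2 / 4)

/-- `w I₀'(w)`. -/
def besselID (w : ℂ) : ℂ := w ^ 2 / 2 * besselF' (w ^ 2 / 4)

lemma hasDerivAt_besselI {w : ℂ} (h0 : w ≠ 0) : HasDerivAt besselI (besselID w / w) w := by
  refine ((hasDerivAt_besselF (w ^ 2 / 4)).comp w (hasDerivAt_sq_div_four w)).congr_deriv ?_
  rw [besselID]
  field_simp

lemma hasDerivAt_besselID (w : ℂ) : HasDerivAt besselID (w * besselI w) w := by
  have hE := ((hasDerivAt_mul_besselF' (w ^ 2 / 4)).comp w (hasDerivAt_sq_div_four w)).const_mul 2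
  refine (hE.congr_of_eventuallyEq (.of_forall fun v => ?_)).congr_deriv ?_
  · simp only [besselID, Function.comp_apply]; ring
  · rw [besselI]; ring

/-- The difference of the Schläfli integral and the series form of `K₀`. -/
def macdonaldDiff (w : ℂ) : ℂ := coshMoment 0 w - macdonaldSeries w

/-- `w` times the derivative of `macdonaldDiff`. -/
def macdonaldDiffD (w : ℂ) : ℂ := -(w * coshMoment 1 w) - macdonaldSeriesD w

lemma hasDerivAt_macdonaldDiff {w : ℂ} (hw : 0 < w.re) :
    HasDerivAt macdonaldDiff (macdonaldDiffD w / w) w := by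
  have h0 : w ≠ 0 := by rintro rfl; simp at hw
  refine ((hasDerivAt_coshMoment 0 hw).sub
    (hasDerivAt_macdonaldSeries (Or.inl hw))).congr_deriv ?_
  rw [macdonaldDiffD]
  field_simp

lemma hasDerivAt_macdonaldDiffD {w : ℂ} (hw : 0 < w.re) :
    HasDerivAt macdonaldDiffD (w * macdonaldDiff w) w := by
  refine ((hasDerivAt_neg_mul_coshMoment_one hw).sub
    (hasDerivAt_macdonaldSeriesD (Or.inl hw))).congr_deriv ?_
  rw [macdonaldDiff]
  ring

lemma tendsto_ofReal_nhdsGT_zero : Tendsto (fun r : ℝ => (r : ℂ)) (𝓝[>] 0) (𝓝 0) :=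
  (Continuous.tendsto' (by fun_prop) 0 0 (by simp)).mono_left nhdsWithin_le_nhds

lemma tendsto_sq_mul_log_ofReal :
    Tendsto (fun r : ℝ => (r : ℂ) ^ 2 * Complex.log r) (𝓝[>] 0) (𝓝 0) := by
  have h := (Complex.continuous_ofReal.tendsto _).comp tendsto_mul_log_nhdsGT
  have h' := tendsto_ofReal_nhdsGT_zero.mul h
  rw [Complex.ofReal_zero, mul_zero] at h'
  refine h'.congr' ?_
  filter_upwards [self_mem_nhdsWithin] with r hr
  rw [Function.comp_apply, Complex.ofReal_mul, Complex.ofReal_log (le_of_lt hr)]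
  ring

lemma isBigO_besselF_sub_one :
    (fun r : ℝ => besselF ((r : ℂ) ^ 2 / 4) - 1) =O[𝓝[>] 0] fun r : ℝ => (r : ℂ) ^ 2 := by
  have h := (hasDerivAt_besselF 0).isBigO_sub
  rw [besselF_zero] at h
  have ht : Tendsto (fun r : ℝ => (r : ℂ) ^ 2 / 4) (𝓝[>] 0) (𝓝 0) :=
    (Continuous.tendsto' (by fun_prop) 0 0 (by simp)).mono_left nhdsWithin_le_nhds
  have h2 := h.comp_tendsto ht
  refine h2.trans ?_
  refine Asymptotics.IsBigO.of_bound 1 (.of_forall fun r => ?_)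
  simp only [Function.comp_apply, sub_zero, norm_div, one_mul]
  exact div_le_self (norm_nonneg _) (by norm_num)

lemma tendsto_sq_div_four_ofReal :
    Tendsto (fun r : ℝ => (r : ℂ) ^ 2 / 4) (𝓝[>] 0) (𝓝 0) :=
  (Continuous.tendsto' (by fun_prop) 0 0 (by simp)).mono_left nhdsWithin_le_nhds

lemma tendsto_log_term_mul_sq :
    Tendsto (fun r : ℝ => (Complex.log r - Real.log 2 + Real.eulerMascheroniConstant)
      * (r : ℂ) ^ 2) (𝓝[>] 0) (𝓝 0) := by
  have h2 : Tendsto (fun r : ℝ => (-(Real.log 2 : ℂ) + Real.eulerMascheroniConstant) * (r : ℂ) ^ 2)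
      (𝓝[>] 0) (𝓝 0) :=
    (Continuous.tendsto' (by fun_prop) 0 0 (by simp)).mono_left nhdsWithin_le_nhds
  have h := tendsto_sq_mul_log_ofReal.add h2
  rw [add_zero] at h
  exact h.congr fun r => by ring

lemma tendsto_macdonaldDiff : Tendsto (fun r : ℝ => macdonaldDiff r) (𝓝[>] 0) (𝓝 0) := by
  have h1 := tendsto_coshMoment_zero_add_log.sub_const
    ((Real.log 2 - Real.eulerMascheroniConstant : ℝ) : ℂ)
  rw [sub_self] at h1
  have h2 : Tendsto (fun r : ℝ => (Complex.log r - Real.log 2 + Real.eulerMascheroniConstant)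
      * (besselF ((r : ℂ) ^ 2 / 4) - 1)) (𝓝[>] 0) (𝓝 0) :=
    ((Asymptotics.isBigO_refl _ _).mul isBigO_besselF_sub_one).trans_tendsto
      tendsto_log_term_mul_sq
  have h3 : Tendsto (fun r : ℝ => besselS ((r : ℂ) ^ 2 / 4)) (𝓝[>] 0) (𝓝 0) := by
    rw [← besselS_zero]
    exact (hasDerivAt_besselS 0).continuousAt.tendsto.comp tendsto_sq_div_four_ofReal
  have h := (h1.add h2).sub h3
  rw [add_zero, sub_zero] at h
  refine h.congr fun r => ?_
  rw [macdonaldDiff, macdonaldSeries]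
  push_cast
  ring

lemma tendsto_mul_coshMoment_one :
    Tendsto (fun r : ℝ => (r : ℂ) * coshMoment 1 r) (𝓝[>] 0) (𝓝 1) := by
  rw [tendsto_iff_norm_sub_tendsto_zero]
  have h := (tendsto_ofReal_nhdsGT_zero.norm).mul_const 2
  rw [norm_zero, zero_mul] at h
  refine squeeze_zero' (.of_forall fun _ => norm_nonneg _) ?_ h
  filter_upwards [self_mem_nhdsWithin] with r hr
  have h0 : (r : ℂ) ≠ 0 := by exact_mod_cast (ne_of_gt hr)
  rw [show (r : ℂ) * coshMoment 1 r - 1 = r * (coshMoment 1 r - (r : ℂ)⁻¹) by field_simp, norm_mul]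
  gcongr
  exact norm_coshMoment_one_sub_inv_le (by simpa using hr)

lemma continuousAt_besselF' (q : ℂ) : ContinuousAt besselF' q :=
  (entireCoeff_bessel.deriv_coeff.hasDerivAt q).continuousAt

lemma continuousAt_besselS' (q : ℂ) : ContinuousAt besselS' q :=
  (entireCoeff_harmonic.deriv_coeff.hasDerivAt q).continuousAt

lemma tendsto_macdonaldDiffD : Tendsto (fun r : ℝ => macdonaldDiffD r) (𝓝[>] 0) (𝓝 0) := by
  have hq := tendsto_sq_div_four_ofReal
  have hF : Tendsto (fun r : ℝ => besselF ((r : ℂ) ^ 2 / 4)) (𝓝[>] 0) (𝓝 1) := by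
    rw [← besselF_zero]
    exact (hasDerivAt_besselF 0).continuousAt.tendsto.comp hq
  have hF' := (continuousAt_besselF' 0).tendsto.comp hq
  have hS' := (continuousAt_besselS' 0).tendsto.comp hq
  have h := ((tendsto_mul_coshMoment_one.neg.add hF).add
    ((tendsto_log_term_mul_sq.mul hF').mul_const (1 / 2))).sub ((hq.mul hS').const_mul 2)
  simp only [zero_mul, mul_zero, add_zero, sub_zero, neg_add_cancel] at h
  refine h.congr fun r => ?_
  simp only [macdonaldDiffD, macdonaldSeriesD, Function.comp_apply]
  ring

lemma tendsto_besselI : Tendsto (fun r : ℝ => besselI r) (𝓝[>] 0) (𝓝 1) := by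
  rw [← besselF_zero]
  exact (hasDerivAt_besselF 0).continuousAt.tendsto.comp tendsto_sq_div_four_ofReal

lemma tendsto_besselID : Tendsto (fun r : ℝ => besselID r) (𝓝[>] 0) (𝓝 0) := by
  have h := (tendsto_sq_div_four_ofReal.mul
    ((continuousAt_besselF' 0).tendsto.comp tendsto_sq_div_four_ofReal)).const_mul 2
  rw [zero_mul, mul_zero] at h
  refine h.congr fun r => ?_
  simp only [besselID, Function.comp_apply]
  ring

lemma eq_of_hasDerivAt_zero_of_tendsto {f : ℝ → ℂ} {l : ℂ}
    (hf : ∀ r : ℝ, 0 < r → HasDerivAt f 0 r) (hl : Tendsto f (𝓝[>] 0) (𝓝 l)) {r : ℝ} (hr : 0 < r) :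
    f r = l := by
  have hc : ∀ x ∈ Ioi (0 : ℝ), f x = f r := fun x hx =>
    isOpen_Ioi.is_const_of_deriv_eq_zero isPreconnected_Ioi
      (fun y hy => (hf y hy).differentiableAt.differentiableWithinAt)
      (fun y hy => (hf y hy).deriv) hx hr
  refine tendsto_nhds_unique (tendsto_const_nhds.congr' ?_) hl
  filter_upwards [self_mem_nhdsWithin] with x hx
  exact (hc x hx).symm

/-- The Wronskian of `macdonaldDiff` and `I₀` vanishes. -/
lemma macdonaldDiff_wronskian {r : ℝ} (hr : 0 < r) :
    macdonaldDiff r * besselID r - macdonaldDiffD r * besselI r = 0 := by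
  refine eq_of_hasDerivAt_zero_of_tendsto
    (f := fun r : ℝ => macdonaldDiff r * besselID r - macdonaldDiffD r * besselI r)
    (fun x hx => ?_) ?_ hr
  · have hx' : 0 < (x : ℂ).re := by simpa using hx
    have h0 : (x : ℂ) ≠ 0 := by exact_mod_cast hx.ne'
    refine (((hasDerivAt_macdonaldDiff hx').mul (hasDerivAt_besselID _)).sub
      ((hasDerivAt_macdonaldDiffD hx').mul (hasDerivAt_besselI h0))).comp_ofReal.congr_deriv ?_
    field_simp
    ring
  · have h := (tendsto_macdonaldDiff.mul tendsto_besselID).sub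
      (tendsto_macdonaldDiffD.mul tendsto_besselI)
    simpa using h

lemma macdonaldDiff_ofReal {r : ℝ} (hr : 0 < r) : macdonaldDiff r = 0 := by
  have hI : ∀ x : ℝ, besselI x ≠ 0 := fun x => by
    have := besselF_ofReal_ne_zero (r := x ^ 2 / 4) (by positivity)
    rw [besselI]
    push_cast at this
    exact this
  have h := eq_of_hasDerivAt_zero_of_tendsto (f := fun r : ℝ => macdonaldDiff r / besselI r)
    (l := 0) (fun x hx => ?_) ?_ hr
  · simpa [hI] using h
  · have hx' : 0 < (x : ℂ).re := by simpa using hx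
    have h0 : (x : ℂ) ≠ 0 := by exact_mod_cast hx.ne'
    refine ((hasDerivAt_macdonaldDiff hx').div (hasDerivAt_besselI h0)
      (hI x)).comp_ofReal.congr_deriv ?_
    rw [div_eq_zero_iff]
    left
    have := macdonaldDiff_wronskian hx
    field_simp
    linear_combination -this
  · have h := tendsto_macdonaldDiff.div tendsto_besselI one_ne_zero
    rw [zero_div] at h
    exact h

/-- The Schläfli integral represents the series form of `K₀` on the right half-plane. -/
lemma coshMoment_zero_eq_series {w : ℂ} (hw : 0 < w.re) : coshMoment 0 w = macdonaldSeries w := by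
  have han : AnalyticOnNhd ℂ macdonaldDiff {w | 0 < w.re} :=
    DifferentiableOn.analyticOnNhd
      (fun w hw => (hasDerivAt_macdonaldDiff hw).differentiableAt.differentiableWithinAt)
      isOpen_re_pos
  have h := han.eqOn_zero_of_preconnected_of_frequently_eq_zero
    convex_re_pos.isPreconnected (z₀ := 1) (by simp) ?_ hw
  · exact sub_eq_zero.1 h
  · have ht : Tendsto (fun r : ℝ => (r : ℂ)) (𝓝[>] 1) (𝓝[≠] 1) := by
      refine tendsto_nhdsWithin_iff.2 ⟨?_, ?_⟩
      · exact (Continuous.tendsto' (by fun_prop) 1 1 (by simp)).mono_left nhdsWithin_le_nhds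
      · filter_upwards [self_mem_nhdsWithin] with r hr
        have : r ≠ 1 := ne_of_gt hr
        simpa using this
    refine ht.frequently (Eventually.frequently ?_)
    filter_upwards [self_mem_nhdsWithin] with r hr
    exact macdonaldDiff_ofReal (lt_trans one_pos hr)

/-- `H₀⁽¹⁾(i w) = -(2 i / π) K₀(w)` for `Re w > 0`. -/
lemma hankelZero_I_mul {w : ℂ} (hw : 0 < w.re) :
    hankelZero (Complex.I * w) = -(2 * Complex.I / Real.pi) * coshMoment 0 w := by
  rw [hankelZero_I_mul_eq_series hw, coshMoment_zero_eq_series hw]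

/-! ### Holomorphic dependence of an integral on a parameter -/

/-- An integral of functions holomorphic in a parameter, locally uniformly dominated, is
holomorphic: Cauchy's estimate turns a bound on the functions into one on their derivatives. -/
lemma differentiableOn_integral_of_locally_dominated {α : Type*} [MeasurableSpace α]
    {μ : Measure α} {F : ℂ → α → ℂ} {V : Set ℂ} (hV : IsOpen V)
    (hmeas : ∀ s, AEStronglyMeasurable (F s) μ)
    (hdiff : ∀ᵐ t ∂μ, DifferentiableOn ℂ (fun s => F s t) V)
    (hbound : ∀ s ∈ V, ∃ W ∈ 𝓝 s, ∃ g : α → ℝ, Integrable g μ ∧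
      ∀ᵐ t ∂μ, ∀ s' ∈ W, ‖F s' t‖ ≤ g t) :
    DifferentiableOn ℂ (fun s => ∫ t, F s t ∂μ) V := by
  intro s₀ hs₀
  obtain ⟨W, hW, g, hg, hgb⟩ := hbound s₀ hs₀
  obtain ⟨ε, hε, hball⟩ := Metric.mem_nhds_iff.1 (inter_mem (hV.mem_nhds hs₀) hW)
  have hsub : ∀ s ∈ Metric.ball s₀ (ε / 2), Metric.closedBall s (ε / 4) ⊆ V ∩ W := by
    intro s hs z hz
    refine hball ?_
    rw [Metric.mem_ball] at hs ⊢
    rw [Metric.mem_closedBall] at hz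
    linarith [dist_triangle z s s₀]
  have hmem : s₀ ∈ Metric.ball s₀ (ε / 2) := Metric.mem_ball_self (by linarith)
  have hmem' : s₀ ∈ V ∩ W := hball (Metric.mem_ball_self hε)
  have hF' : AEStronglyMeasurable (fun t => deriv (fun s => F s t) s₀) μ := by
    refine aestronglyMeasurable_of_tendsto_ae (𝓝[≠] s₀)
      (f := fun s t => slope (fun s => F s t) s₀ s) (fun s => ?_) ?_
    · simp only [slope_def_module]
      exact ((hmeas s).sub (hmeas s₀)).const_smul (s - s₀)⁻¹
    · filter_upwards [hdiff] with t ht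
      exact hasDerivAt_iff_tendsto_slope.1 ((ht s₀ hs₀).differentiableAt
        (hV.mem_nhds hs₀)).hasDerivAt
  refine (hasDerivAt_integral_of_dominated_loc_of_deriv_le (𝕜 := ℂ)
    (F' := fun s t => deriv (fun s => F s t) s) (bound := fun t => g t / (ε / 4))
    (Metric.ball_mem_nhds s₀ (half_pos hε)) (.of_forall hmeas)
    (hg.mono' (hmeas s₀) (hgb.mono fun t ht => ht s₀ hmem'.2)) hF' ?_ (hg.div_const _)
    ?_).2.differentiableAt.differentiableWithinAt
  · filter_upwards [hdiff, hgb] with t ht htb s hs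
    refine Complex.norm_deriv_le_of_forall_mem_sphere_norm_le (by linarith) ?_ fun z hz => ?_
    · refine DifferentiableOn.diffContOnCl_ball (U := V) ht fun z hz => (hsub s hs hz).1
    · exact htb z (hsub s hs (Metric.sphere_subset_closedBall hz)).2
  · filter_upwards [hdiff] with t ht s hs
    have hsV := (hsub s hs (Metric.mem_closedBall_self (by linarith))).1
    exact ((ht s hsV).differentiableAt (hV.mem_nhds hsV)).hasDerivAt

namespace Possio

/-! ### The argument of the Hankel function -/

/-- The distance `√((d/(a(1-M²)))² + (y/(a√(1-M²)))²)`, written with `θ = 1/(a(1-M²))` and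
`ν = 1/(a√(1-M²))`; the argument of the Hankel function is `i s` times it. -/
def radius (θ ν d y : ℝ) : ℝ := Real.sqrt (θ ^ 2 * d ^ 2 + ν ^ 2 * y ^ 2)

lemma radius_zero {θ : ℝ} (hθ : 0 ≤ θ) (ν d : ℝ) : radius θ ν d 0 = θ * |d| := by
  rw [radius, ← mul_pow, show ν ^ 2 * (0 : ℝ) ^ 2 = 0 by ring, add_zero, Real.sqrt_sq_eq_abs,
    abs_mul, abs_of_nonneg hθ]

lemma le_radius {θ : ℝ} (hθ : 0 ≤ θ) (ν d y : ℝ) : θ * |d| ≤ radius θ ν d y := by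
  rw [← radius_zero hθ ν]
  exact Real.sqrt_le_sqrt (by nlinarith [sq_nonneg (ν * y)])

lemma radius_pos {ν y : ℝ} (hν : 0 < ν) (hy : 0 < y) (θ d : ℝ) : 0 < radius θ ν d y :=
  Real.sqrt_pos.2 (by positivity)

lemma tendsto_radius {θ : ℝ} (hθ : 0 ≤ θ) (ν d : ℝ) :
    Tendsto (fun y => radius θ ν d y) (𝓝[>] 0) (𝓝 (θ * |d|)) := by
  rw [← radius_zero hθ ν]
  have h : Continuous fun y => radius θ ν d y := by unfold radius; fun_prop
  exact (h.tendsto 0).mono_left nhdsWithin_le_nhds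

lemma hasDerivAt_radius {θ ν d y : ℝ} (h : 0 < radius θ ν d y) :
    HasDerivAt (fun d => radius θ ν d y) (θ ^ 2 * d / radius θ ν d y) d := by
  have h0 : θ ^ 2 * d ^ 2 + ν ^ 2 * y ^ 2 ≠ 0 := (Real.sqrt_pos.1 h).ne'
  have h1 := (((hasDerivAt_pow 2 d).const_mul (θ ^ 2)).add_const (ν ^ 2 * y ^ 2)).sqrt h0
  refine h1.congr_deriv ?_
  rw [radius, div_eq_div_iff (by have := h.ne'; rw [radius] at this; positivity)
    (by have := h.ne'; rwa [radius] at this)]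
  push_cast
  ring

lemma arg_eq {a M : ℝ} (ha : 0 < a) (hM : 0 < 1 - M ^ 2) (s : ℂ) (ξ x y : ℝ) :
    arg a M s ξ 0 x y = Complex.I *
      (s * radius (1 / (a * (1 - M ^ 2))) (1 / (a * Real.sqrt (1 - M ^ 2))) (x - ξ) y) := by
  have hb : 0 < Real.sqrt (1 - M ^ 2) := Real.sqrt_pos.2 hM
  have hsq : Real.sqrt (1 - M ^ 2) ^ 2 = 1 - M ^ 2 := Real.sq_sqrt hM.le
  have h : radius (1 / (a * (1 - M ^ 2))) (1 / (a * Real.sqrt (1 - M ^ 2))) (x - ξ) y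
      = Real.sqrt ((x - ξ) ^ 2 / (1 - M ^ 2) + y ^ 2) / (a * Real.sqrt (1 - M ^ 2)) := by
    rw [radius, eq_div_iff (by positivity)]
    rw [← Real.sqrt_sq (show 0 ≤ a * Real.sqrt (1 - M ^ 2) by positivity),
      ← Real.sqrt_mul (by positivity)]
    congr 1
    rw [Real.sqrt_sq (by positivity), div_pow, div_pow, mul_pow, mul_pow, hsq]
    field_simp
  rw [h, arg, sub_zero]
  push_cast
  ring

lemma re_mul_ofReal_pos {s : ℂ} {ρ : ℝ} (hs : 0 < s.re) (hρ : 0 < ρ) : 0 < (s * ρ).re := by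
  rw [Complex.re_mul_ofReal]; positivity

lemma differentiableAt_coshMoment_mul (n : ℕ) {s : ℂ} {ρ : ℝ} (hs : 0 < s.re) (hρ : 0 < ρ) :
    DifferentiableAt ℂ (fun s : ℂ => coshMoment n (s * ρ)) s :=
  DifferentiableAt.comp (g := coshMoment n) s
    (hasDerivAt_coshMoment n (re_mul_ofReal_pos hs hρ)).differentiableAt (by fun_prop)

/-! ### The integral over the wake -/

/-- The integrand of the integral term, at distance `y` from the line, after replacing the Hankel
function by `K₀`. -/
def wakeIntegrand (m θ ν x ξ y : ℝ) (s : ℂ) (u : ℝ) : ℂ :=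
  Complex.exp (-(m * s * (x - u))) * coshMoment 0 (s * radius θ ν (u - ξ) y)

/-- The integral term on the line `y = 0`. -/
def wakeIntegral (m θ x ξ : ℝ) (s : ℂ) : ℂ :=
  ∫ u in Iic x, Complex.exp (-(m * s * (x - u))) * coshMoment 0 (s * (θ * |u - ξ| : ℝ))

lemma stronglyMeasurable_wakeIntegrand (m θ ν x ξ y : ℝ) (s : ℂ) :
    StronglyMeasurable (wakeIntegrand m θ ν x ξ y s) := by
  refine StronglyMeasurable.mul (Continuous.stronglyMeasurable (by fun_prop)) ?_
  refine (stronglyMeasurable_coshMoment 0).comp_measurable (Continuous.measurable ?_)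
  unfold radius
  fun_prop

/-- The dominating function of the integrand, which depends neither on `y` nor on `x`. -/
lemma norm_wakeIntegrand_le {m θ ν x ξ y σ : ℝ} {s : ℂ} {u : ℝ} (hm : 0 ≤ m) (hθ : 0 < θ)
    (hσ : 0 < σ) (hs : σ ≤ s.re) (hux : u ≤ x) (hu : u ≠ ξ) :
    ‖wakeIntegrand m θ ν x ξ y s u‖ ≤ macdonaldReal (σ * θ * |u - ξ|) := by
  have hd : 0 < |u - ξ| := abs_pos.2 (sub_ne_zero.2 hu)
  have h1 : ‖Complex.exp (-(m * s * (x - u)))‖ ≤ 1 := by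
    rw [Complex.norm_exp]
    refine Real.exp_le_one_iff.2 ?_
    have : (-(m * s * (x - u)) : ℂ).re = -(m * s.re * (x - u)) := by
      rw [← Complex.ofReal_sub, Complex.neg_re, Complex.re_mul_ofReal, Complex.re_ofReal_mul]
    rw [this]
    have : 0 ≤ m * s.re * (x - u) := mul_nonneg (mul_nonneg hm (hσ.le.trans hs)) (sub_nonneg.2 hux)
    linarith
  have h2 : ‖coshMoment 0 (s * radius θ ν (u - ξ) y)‖ ≤ macdonaldReal (σ * θ * |u - ξ|) := by
    refine norm_coshMoment_zero_le (by positivity) ?_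
    rw [Complex.re_mul_ofReal, mul_assoc]
    exact mul_le_mul hs (le_radius hθ.le ν _ y) (by positivity) (hσ.le.trans hs)
  rw [wakeIntegrand, norm_mul]
  calc _ ≤ 1 * macdonaldReal (σ * θ * |u - ξ|) := by gcongr
    _ = _ := one_mul _

lemma integrable_dominating {σ : ℝ} (hσ : 0 < σ) (ξ : ℝ) :
    Integrable fun u : ℝ => macdonaldReal (σ * |u - ξ|) :=
  (integrable_macdonaldReal_abs hσ).comp_sub_right ξ

lemma ae_restrict_le_and_ne (x ξ : ℝ) : ∀ᵐ u ∂(volume.restrict (Iic x)), u ≤ x ∧ u ≠ ξ :=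
  (ae_restrict_mem measurableSet_Iic).and (ae_restrict_of_ae (Measure.ae_ne volume ξ))

lemma ae_norm_wakeIntegrand_le {m θ ν x ξ y σ : ℝ} {s : ℂ} (hm : 0 ≤ m) (hθ : 0 < θ)
    (hσ : 0 < σ) (hs : σ ≤ s.re) : ∀ᵐ u ∂(volume.restrict (Iic x)),
      ‖wakeIntegrand m θ ν x ξ y s u‖ ≤ macdonaldReal (σ * θ * |u - ξ|) :=
  (ae_restrict_le_and_ne x ξ).mono fun _ hu => norm_wakeIntegrand_le hm hθ hσ hs hu.1 hu.2

lemma integrableOn_wakeIntegrand {m θ : ℝ} (hm : 0 ≤ m) (hθ : 0 < θ) (ν x ξ y : ℝ) {s : ℂ}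
    (hs : 0 < s.re) : IntegrableOn (wakeIntegrand m θ ν x ξ y s) (Iic x) :=
  (integrable_dominating (mul_pos hs hθ) ξ).integrableOn.mono'
    (stronglyMeasurable_wakeIntegrand m θ ν x ξ y s).aestronglyMeasurable
    (ae_norm_wakeIntegrand_le hm hθ hs le_rfl)

lemma wakeIntegral_eq (m x ξ ν : ℝ) {θ : ℝ} (hθ : 0 ≤ θ) (s : ℂ) :
    wakeIntegral m θ x ξ s = ∫ u in Iic x, wakeIntegrand m θ ν x ξ 0 s u := by
  simp only [wakeIntegral, wakeIntegrand, radius_zero hθ]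

lemma tendsto_integral_wakeIntegrand {m θ : ℝ} (hm : 0 ≤ m) (hθ : 0 < θ) (ν x ξ : ℝ) {s : ℂ}
    (hs : 0 < s.re) :
    Tendsto (fun y => ∫ u in Iic x, wakeIntegrand m θ ν x ξ y s u) (𝓝[>] 0)
      (𝓝 (wakeIntegral m θ x ξ s)) := by
  rw [wakeIntegral]
  refine tendsto_integral_filter_of_dominated_convergence
    (fun u => macdonaldReal (s.re * θ * |u - ξ|))
    (.of_forall fun y => (stronglyMeasurable_wakeIntegrand m θ ν x ξ y s).aestronglyMeasurable)
    (.of_forall fun y => ae_norm_wakeIntegrand_le hm hθ hs le_rfl)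
    (integrable_dominating (mul_pos hs hθ) ξ).integrableOn ?_
  filter_upwards [ae_restrict_le_and_ne x ξ] with u hu
  have hd : 0 < θ * |u - ξ| := mul_pos hθ (abs_pos.2 (sub_ne_zero.2 hu.2))
  refine Tendsto.const_mul _ ((continuousAt_coshMoment 0 (re_mul_ofReal_pos hs hd)).tendsto.comp ?_)
  exact ((Complex.continuous_ofReal.tendsto _).comp (tendsto_radius hθ.le ν _)).const_mul s

lemma norm_wakeIntegral_le {m θ σ : ℝ} (hm : 0 ≤ m) (hθ : 0 < θ) (hσ : 0 < σ) (x ξ : ℝ) {s : ℂ}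
    (hs : σ ≤ s.re) : ‖wakeIntegral m θ x ξ s‖ ≤ ∫ v : ℝ, macdonaldReal (σ * θ * |v|) := by
  have hi := integrable_dominating (mul_pos hσ hθ) ξ
  rw [wakeIntegral_eq m x ξ 0 hθ.le]
  calc _ ≤ ∫ u in Iic x, macdonaldReal (σ * θ * |u - ξ|) :=
        norm_integral_le_of_norm_le hi.integrableOn (ae_norm_wakeIntegrand_le hm hθ hσ hs)
    _ ≤ ∫ u, macdonaldReal (σ * θ * |u - ξ|) :=
        setIntegral_le_integral hi (.of_forall fun u => macdonaldReal_nonneg _)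
    _ = _ := integral_sub_right_eq_self (fun v => macdonaldReal (σ * θ * |v|)) ξ

lemma differentiableOn_wakeIntegral {m θ : ℝ} (hm : 0 ≤ m) (hθ : 0 < θ) (x ξ : ℝ) :
    DifferentiableOn ℂ (wakeIntegral m θ x ξ) {s | 0 < s.re} := by
  rw [funext (wakeIntegral_eq m x ξ 0 hθ.le)]
  refine differentiableOn_integral_of_locally_dominated isOpen_re_pos
    (fun s => (stronglyMeasurable_wakeIntegrand m θ 0 x ξ 0 s).aestronglyMeasurable) ?_ ?_
  · filter_upwards [ae_restrict_le_and_ne x ξ] with u hu s hs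
    have hs : 0 < s.re := hs
    have hd : 0 < radius θ 0 (u - ξ) 0 := by
      rw [radius_zero hθ.le]; exact mul_pos hθ (abs_pos.2 (sub_ne_zero.2 hu.2))
    exact (DifferentiableAt.mul (by fun_prop)
      (differentiableAt_coshMoment_mul 0 hs hd)).differentiableWithinAt
  · intro s hs
    have hs : 0 < s.re := hs
    refine ⟨{s' | s.re / 2 < s'.re}, (isOpen_lt continuous_const Complex.continuous_re).mem_nhds
      (by change s.re / 2 < s.re; linarith), _,
      (integrable_dominating (mul_pos (half_pos hs) hθ) ξ).integrableOn, ?_⟩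
    filter_upwards [ae_restrict_le_and_ne x ξ] with u hu s' hs'
    exact norm_wakeIntegrand_le hm hθ (half_pos hs) (le_of_lt hs') hu.1 hu.2

/-! ### The decomposition of the kernel -/

/-- `K₀(w) + log w`, extended to `w = 0` by its limit `log 2 - γ`. -/
def regularK (w : ℂ) : ℂ :=
  if w = 0 then ((Real.log 2 - Real.eulerMascheroniConstant : ℝ) : ℂ)
  else coshMoment 0 w + Complex.log w

lemma norm_regularK_le {w : ℂ} (hw : w = 0 ∨ 0 < w.re) :
    ‖regularK w‖ ≤ |Real.log 2 - Real.eulerMascheroniConstant| + 2 * ‖w‖ := by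
  have h : ‖regularK w - ((Real.log 2 - Real.eulerMascheroniConstant : ℝ) : ℂ)‖ ≤ 2 * ‖w‖ := by
    rcases hw with rfl | hw
    · simp [regularK]
    · have h0 : w ≠ 0 := by rintro rfl; simp at hw
      rw [regularK, if_neg h0]
      exact norm_coshMoment_zero_add_log_sub_const_le hw
  have h2 := norm_add_le (((Real.log 2 - Real.eulerMascheroniConstant : ℝ) : ℂ))
    (regularK w - ((Real.log 2 - Real.eulerMascheroniConstant : ℝ) : ℂ))
  rw [add_sub_cancel, Complex.norm_real, Real.norm_eq_abs] at h2
  linarith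

/-- The coefficient `A` of the logarithm; it depends on `s` only. -/
def logCoeff (U : ℝ) (s : ℂ) : ℂ := -(2 * Complex.I / Real.pi) * (s / U ^ 2)

/-- The bounded part `B` of the kernel, as a function of `d = x - ξ`, `s` and the value `w` of the
integral over the wake, with `θ = 1/(a(1-M²))` and `b = 1 - M²`. On the diagonal `d = 0` the first
term vanishes and `regularK` takes its limit value. -/
def boundedPart (U b θ d : ℝ) (w s : ℂ) : ℂ :=
  2 * Complex.I / Real.pi *
    (b / U * (s * θ * (SignType.sign d : ℝ)
        * (coshMoment 1 (s * (θ * |d| : ℝ)) - (s * (θ * |d| : ℝ))⁻¹))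
      + s / U ^ 2 * (regularK (s * (θ * |d| : ℝ)) - Complex.log (s * θ))
      - s ^ 2 / U ^ 3 * w)

lemma differentiableOn_boundedPart {U b θ : ℝ} (hθ : 0 < θ) (d : ℝ) {f : ℂ → ℂ}
    (hf : DifferentiableOn ℂ f {s | 0 < s.re}) :
    DifferentiableOn ℂ (fun s => boundedPart U b θ d (f s) s) {s | 0 < s.re} := by
  intro s hs
  have hs' : 0 < s.re := hs
  have hf' : DifferentiableAt ℂ f s := (hf s hs).differentiableAt (isOpen_re_pos.mem_nhds hs)
  have hlog : DifferentiableAt ℂ (fun s : ℂ => Complex.log (s * θ)) s :=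
    (by fun_prop : DifferentiableAt ℂ (fun s : ℂ => s * (θ : ℂ)) s).clog
      (Or.inl (re_mul_ofReal_pos hs' hθ))
  refine DifferentiableAt.differentiableWithinAt ?_
  rcases eq_or_ne d 0 with rfl | hd
  · simp only [boundedPart, sign_zero, SignType.coe_zero, abs_zero, mul_zero, Complex.ofReal_zero,
      zero_mul]
    fun_prop
  · have hρ : 0 < θ * |d| := mul_pos hθ (abs_pos.2 hd)
    have hw := re_mul_ofReal_pos hs' hρ
    have h0 : s * ((θ * |d| : ℝ) : ℂ) ≠ 0 := by
      intro h; rw [h] at hw; simp at hw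
    have hlin : DifferentiableAt ℂ (fun s : ℂ => s * ((θ * |d| : ℝ) : ℂ)) s := by fun_prop
    have h1 : DifferentiableAt ℂ (fun s : ℂ => coshMoment 1 (s * ((θ * |d| : ℝ) : ℂ))) s :=
      differentiableAt_coshMoment_mul 1 hs' hρ
    have h2 : DifferentiableAt ℂ (fun s : ℂ => (s * ((θ * |d| : ℝ) : ℂ))⁻¹) s := hlin.inv h0
    have h3 : DifferentiableAt ℂ (fun s : ℂ => regularK (s * ((θ * |d| : ℝ) : ℂ))) s := by
      have h4 : DifferentiableAt ℂ (fun s : ℂ => coshMoment 0 (s * ((θ * |d| : ℝ) : ℂ))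
          + Complex.log (s * ((θ * |d| : ℝ) : ℂ))) s :=
        (differentiableAt_coshMoment_mul 0 hs' hρ).add (hlin.clog (Or.inl hw))
      refine h4.congr_of_eventuallyEq ?_
      filter_upwards [hlin.continuousAt.eventually_ne h0] with s' hs'
      rw [regularK, if_neg hs']
    unfold boundedPart
    fun_prop

lemma abs_log_le_add_inv {x : ℝ} (hx : 0 < x) : |Real.log x| ≤ x + x⁻¹ := by
  have h1 := Real.log_le_sub_one_of_pos hx
  have h2 := Real.log_le_sub_one_of_pos (inv_pos.2 hx)
  rw [Real.log_inv] at h2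
  have := inv_pos.2 hx
  exact abs_le.2 ⟨by linarith, by linarith⟩

lemma norm_log_mul_le {s : ℂ} {σ θ : ℝ} (hσ : 0 < σ) (hθ : 0 < θ) (hs : σ ≤ ‖s‖) :
    ‖Complex.log (s * θ)‖ ≤ ‖s‖ * θ + (σ * θ)⁻¹ + Real.pi := by
  have hn : ‖s * θ‖ = ‖s‖ * θ := by
    rw [norm_mul, Complex.norm_real, Real.norm_of_nonneg hθ.le]
  have hpos : 0 < ‖s‖ * θ := mul_pos (hσ.trans_le hs) hθ
  have h1 := Complex.norm_le_abs_re_add_abs_im (Complex.log (s * θ))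
  rw [Complex.log_re, Complex.log_im, hn] at h1
  have h2 := abs_log_le_add_inv hpos
  have h3 : (‖s‖ * θ)⁻¹ ≤ (σ * θ)⁻¹ := by gcongr
  linarith [Complex.abs_arg_le_pi (s * θ)]

/-- The bound `C |s|²` on the bounded part, for `Re s ≥ σ`. -/
lemma exists_norm_boundedPart_le (U b : ℝ) {θ σ G : ℝ} (hθ : 0 < θ) (hσ : 0 < σ) :
    ∃ C : ℝ, ∀ (d : ℝ) (w s : ℂ), |d| ≤ 2 → ‖w‖ ≤ G → σ ≤ s.re →
      ‖boundedPart U b θ d w s‖ ≤ C * ‖s‖ ^ 2 := by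
  -- constants such as `p` are absorbed by `p ≤ (p / σ) |s|`
  let p : ℝ := |Real.log 2 - Real.eulerMascheroniConstant| + (σ * θ)⁻¹ + Real.pi
  refine ⟨‖2 * Complex.I / (Real.pi : ℂ)‖ * (|b| / |U| * (θ * 2 / σ)
    + 1 / |U| ^ 2 * (p / σ + 5 * θ) + 1 / |U| ^ 3 * G), fun d w s hd hw hs => ?_⟩
  have hsn : σ ≤ ‖s‖ := hs.trans (Complex.re_le_norm s)
  have hs0 : 0 < s.re := hσ.trans_le hs
  have hn : ‖s * ((θ * |d| : ℝ) : ℂ)‖ ≤ ‖s‖ * (θ * 2) := by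
    rw [norm_mul, Complex.norm_real, Real.norm_of_nonneg (by positivity)]
    gcongr
  have h1 : ‖s * θ * ((SignType.sign d : ℝ) : ℂ)
      * (coshMoment 1 (s * (θ * |d| : ℝ)) - (s * (θ * |d| : ℝ))⁻¹)‖ ≤ ‖s‖ * θ * 2 := by
    rcases eq_or_ne d 0 with rfl | hd0
    · simp only [sign_zero, SignType.coe_zero, Complex.ofReal_zero, mul_zero, zero_mul, norm_zero]
      positivity
    · have hsign : ‖((SignType.sign d : ℝ) : ℂ)‖ = 1 := by
        rcases lt_or_gt_of_ne hd0 with h | h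
        · simp [sign_neg h]
        · simp [sign_pos h]
      rw [norm_mul, norm_mul, hsign, norm_mul, Complex.norm_real, Real.norm_of_nonneg hθ.le,
        mul_one]
      gcongr
      exact norm_coshMoment_one_sub_inv_le
        (re_mul_ofReal_pos hs0 (mul_pos hθ (abs_pos.2 hd0)))
  have h2 : ‖regularK (s * (θ * |d| : ℝ)) - Complex.log (s * θ)‖ ≤ (p / σ + 5 * θ) * ‖s‖ := by
    have e1 : ‖regularK (s * (θ * |d| : ℝ))‖
        ≤ |Real.log 2 - Real.eulerMascheroniConstant| + 2 * ‖s * ((θ * |d| : ℝ) : ℂ)‖ := by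
      refine norm_regularK_le ?_
      rcases eq_or_ne d 0 with rfl | hd0
      · left; simp
      · right; exact re_mul_ofReal_pos hs0 (mul_pos hθ (abs_pos.2 hd0))
    have e2 := norm_log_mul_le hσ hθ hsn
    have hp : 0 ≤ p := by positivity
    have e3 : p ≤ p / σ * ‖s‖ := by
      rw [div_mul_eq_mul_div, le_div_iff₀ hσ]
      gcongr
    have e4 := norm_sub_le (regularK (s * ((θ * |d| : ℝ) : ℂ))) (Complex.log (s * θ))
    have e5 : p = |Real.log 2 - Real.eulerMascheroniConstant| + (σ * θ)⁻¹ + Real.pi := rfl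
    nlinarith
  have h3 : ‖s‖ ≤ ‖s‖ ^ 2 / σ := by
    rw [le_div_iff₀ hσ, sq]; gcongr
  have hU : ∀ k : ℕ, ‖(U : ℂ) ^ k‖ = |U| ^ k := fun k => by
    rw [norm_pow, Complex.norm_real, Real.norm_eq_abs]
  rw [boundedPart, norm_mul]
  refine (mul_le_mul_of_nonneg_left ?_ (norm_nonneg _)).trans_eq (mul_assoc _ _ _).symm
  refine (norm_sub_le _ _).trans ?_
  rw [add_mul, add_mul]
  refine add_le_add ((norm_add_le _ _).trans (add_le_add ?_ ?_)) ?_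
  · rw [norm_mul, norm_div, Complex.norm_real, Complex.norm_real, Real.norm_eq_abs,
      Real.norm_eq_abs]
    calc _ ≤ |b| / |U| * (‖s‖ * θ * 2) := mul_le_mul_of_nonneg_left h1 (by positivity)
      _ ≤ |b| / |U| * (‖s‖ ^ 2 / σ * θ * 2) := by gcongr
      _ = _ := by ring
  · rw [norm_mul, norm_div, hU]
    calc _ ≤ ‖s‖ / |U| ^ 2 * ((p / σ + 5 * θ) * ‖s‖) := by gcongr
      _ = _ := by ring
  · rw [norm_mul, norm_div, hU, norm_pow]
    calc _ ≤ ‖s‖ ^ 2 / |U| ^ 3 * G := by gcongr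
      _ = _ := by ring

lemma exists_norm_logCoeff_le (U : ℝ) {σ : ℝ} (hσ : 0 < σ) :
    ∃ C : ℝ, ∀ s : ℂ, σ ≤ s.re → ‖logCoeff U s‖ ≤ C * ‖s‖ ^ 2 := by
  refine ⟨‖(2 * Complex.I / (Real.pi : ℂ))‖ / (|U| ^ 2 * σ), fun s hs => ?_⟩
  have h3 : ‖s‖ ≤ ‖s‖ ^ 2 / σ := by
    rw [le_div_iff₀ hσ, sq]; gcongr; exact hs.trans (Complex.re_le_norm s)
  rw [logCoeff, norm_mul, norm_neg, norm_div s, norm_pow, Complex.norm_real, Real.norm_eq_abs]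
  calc _ ≤ ‖(2 * Complex.I / (Real.pi : ℂ))‖ * (‖s‖ ^ 2 / σ / |U| ^ 2) := by gcongr
    _ = _ := by ring

/-! ### The limit of the bracket -/

lemma hasDerivAt_hankelZero_arg {a M : ℝ} (ha : 0 < a) (hM : 0 < 1 - M ^ 2) {s : ℂ}
    (hs : 0 < s.re) (ξ x : ℝ) {y : ℝ} (hy : 0 < y) {θ ν : ℝ} (hθ : θ = 1 / (a * (1 - M ^ 2)))
    (hν : ν = 1 / (a * Real.sqrt (1 - M ^ 2))) :
    HasDerivAt (fun x' : ℝ => hankelZero (arg a M s ξ 0 x' y))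
      (2 * Complex.I / Real.pi * (coshMoment 1 (s * radius θ ν (x - ξ) y)
        * (s * (θ ^ 2 * (x - ξ) / radius θ ν (x - ξ) y : ℝ)))) x := by
  have hνpos : 0 < ν := by rw [hν]; positivity
  have hfun : (fun x' : ℝ => hankelZero (arg a M s ξ 0 x' y))
      = fun x' : ℝ => -(2 * Complex.I / Real.pi) * coshMoment 0 (s * radius θ ν (x' - ξ) y) := by
    funext x'
    rw [arg_eq ha hM, ← hθ, ← hν,
      hankelZero_I_mul (re_mul_ofReal_pos hs (radius_pos hνpos hy _ _))]
  have hpos := radius_pos hνpos hy θ (x - ξ)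
  have h1 : HasDerivAt (fun x' : ℝ => radius θ ν (x' - ξ) y)
      (θ ^ 2 * (x - ξ) / radius θ ν (x - ξ) y) x := by
    simpa using (hasDerivAt_radius hpos).comp_sub_const x ξ
  have h2 := (hasDerivAt_coshMoment 0 (re_mul_ofReal_pos hs hpos)).comp x
    (h1.ofReal_comp.const_mul s)
  rw [hfun]
  refine (h2.const_mul _).congr_deriv ?_
  rw [zero_add]
  ring

lemma hankelZero_arg_eq {a M : ℝ} (ha : 0 < a) (hM : 0 < 1 - M ^ 2) {s : ℂ}
    (hs : 0 < s.re) (ξ x : ℝ) {y : ℝ} (hy : 0 < y) {θ ν : ℝ} (hθ : θ = 1 / (a * (1 - M ^ 2)))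
    (hν : ν = 1 / (a * Real.sqrt (1 - M ^ 2))) :
    hankelZero (arg a M s ξ 0 x y)
      = -(2 * Complex.I / Real.pi) * coshMoment 0 (s * radius θ ν (x - ξ) y) := by
  have hνpos : 0 < ν := by rw [hν]; positivity
  rw [arg_eq ha hM, ← hθ, ← hν,
    hankelZero_I_mul (re_mul_ofReal_pos hs (radius_pos hνpos hy _ _))]

lemma lam_eq {a U M : ℝ} (ha : 0 < a) (hU : 0 < U) (hM : M = U / a) (hM1 : 0 < 1 - M ^ 2)
    (s : ℂ) : lam a U M s = -((1 / (U * (1 - M ^ 2)) : ℝ) * s) := by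
  have h : 1 + c a M * U = 1 / (1 - M ^ 2) := by
    have hU' : U = M * a := by rw [hM]; field_simp
    rw [c, hU']
    field_simp
    ring
  have hUc : (U : ℂ) ≠ 0 := by exact_mod_cast hU.ne'
  have hMc : (1 : ℂ) - (M : ℂ) ^ 2 ≠ 0 := by exact_mod_cast hM1.ne'
  rw [lam, h]
  push_cast
  field_simp

lemma lam_sq_coeff {a U M : ℝ} (ha : 0 < a) (hU : 0 < U) (hM : M = U / a) (hM1 : 0 < 1 - M ^ 2)
    (s : ℂ) : lam a U M s ^ 2 * ((1 - M ^ 2 : ℝ) : ℂ) - s ^ 2 / ((a ^ 2 * (1 - M ^ 2) : ℝ) : ℂ)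
      = s ^ 2 / U ^ 2 := by
  have hUc : (U : ℂ) ≠ 0 := by exact_mod_cast hU.ne'
  have hac : (a : ℂ) ≠ 0 := by exact_mod_cast ha.ne'
  have hMc : (1 : ℂ) - (M : ℂ) ^ 2 ≠ 0 := by exact_mod_cast hM1.ne'
  have hMU : (M : ℂ) * a = U := by rw [hM]; push_cast; field_simp
  rw [lam_eq ha hU hM hM1]
  push_cast
  field_simp
  rw [← hMU]
  ring

lemma exp_lam_mul_eq {a U M m : ℝ} (ha : 0 < a) (hU : 0 < U) (hM : M = U / a)
    (hM1 : 0 < 1 - M ^ 2) (hm : m = 1 / (U * (1 - M ^ 2))) (s : ℂ) (x u : ℝ) :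
    Complex.exp (lam a U M s * x) * Complex.exp (-(lam a U M s * u))
      = Complex.exp (-(m * s * (x - u))) := by
  rw [← Complex.exp_add, lam_eq ha hU hM hM1, ← hm]
  ring_nf

/-- The integrand of the integral term in terms of `wakeIntegrand`. -/
lemma exp_mul_hankelZero_eq {a U M m θ ν : ℝ} (ha : 0 < a) (hU : 0 < U) (hM : M = U / a)
    (hM1 : 0 < 1 - M ^ 2) (hm : m = 1 / (U * (1 - M ^ 2))) (hθ : θ = 1 / (a * (1 - M ^ 2)))
    (hν : ν = 1 / (a * Real.sqrt (1 - M ^ 2))) {s : ℂ} (hs : 0 < s.re) (x ξ : ℝ) {y : ℝ}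
    (hy : 0 < y) (u : ℝ) :
    Complex.exp (-(lam a U M s * u)) * hankelZero (arg a M s ξ 0 u y)
      = -(2 * Complex.I / Real.pi) * Complex.exp (-(lam a U M s * x))
        * wakeIntegrand m θ ν x ξ y s u := by
  rw [wakeIntegrand, ← exp_lam_mul_eq ha hU hM hM1 hm s x u,
    hankelZero_arg_eq ha hM1 hs ξ u hy hθ hν]
  have h : Complex.exp (-(lam a U M s * x)) * Complex.exp (lam a U M s * x) = 1 := by
    rw [← Complex.exp_add, neg_add_cancel, Complex.exp_zero]
  linear_combination (2 * Complex.I / Real.pi * Complex.exp (-(lam a U M s * u))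
    * coshMoment 0 (s * radius θ ν (u - ξ) y)) * h

lemma bracket_eq {a U M m θ ν : ℝ} (ha : 0 < a) (hU : 0 < U) (hM : M = U / a)
    (hM1 : 0 < 1 - M ^ 2) (hm : m = 1 / (U * (1 - M ^ 2))) (hθ : θ = 1 / (a * (1 - M ^ 2)))
    (hν : ν = 1 / (a * Real.sqrt (1 - M ^ 2))) {s : ℂ} (hs : 0 < s.re) (x ξ : ℝ) {y : ℝ}
    (hy : 0 < y) :
    bracket a U M s x ξ y = 2 * Complex.I / Real.pi *
      (((1 - M ^ 2 : ℝ) : ℂ) / U * (coshMoment 1 (s * radius θ ν (x - ξ) y)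
          * (s * (θ ^ 2 * (x - ξ) / radius θ ν (x - ξ) y : ℝ)))
        + s / U ^ 2 * coshMoment 0 (s * radius θ ν (x - ξ) y)
        - s ^ 2 / U ^ 3 * ∫ u in Iic x, wakeIntegrand m θ ν x ξ y s u) := by
  have hUc : (U : ℂ) ≠ 0 := by exact_mod_cast hU.ne'
  have hMc : (1 : ℂ) - (M : ℂ) ^ 2 ≠ 0 := by exact_mod_cast hM1.ne'
  have h : Complex.exp (lam a U M s * x) * Complex.exp (-(lam a U M s * x)) = 1 := by
    rw [← Complex.exp_add, add_neg_cancel, Complex.exp_zero]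
  have hl : lam a U M s * ((1 - M ^ 2 : ℝ) : ℂ) / U = -(s / U ^ 2) := by
    rw [lam_eq ha hU hM hM1]
    push_cast
    field_simp
  rw [bracket, (hasDerivAt_hankelZero_arg ha hM1 hs ξ x hy hθ hν).deriv, lam_sq_coeff ha hU hM hM1,
    hl, hankelZero_arg_eq ha hM1 hs ξ x hy hθ hν]
  simp_rw [exp_mul_hankelZero_eq ha hU hM hM1 hm hθ hν hs x ξ hy]
  rw [integral_const_mul]
  linear_combination (-(2 * Complex.I / Real.pi) * (s ^ 2 / U ^ 3)
    * ∫ u in Iic x, wakeIntegrand m θ ν x ξ y s u) * h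

lemma tendsto_bracket {a U M m θ : ℝ} (ha : 0 < a) (hU : 0 < U) (hM : M = U / a)
    (hM1 : 0 < 1 - M ^ 2) (hm : m = 1 / (U * (1 - M ^ 2))) (hθ : θ = 1 / (a * (1 - M ^ 2)))
    {s : ℂ} (hs : 0 < s.re) {x ξ : ℝ} (hx : x ≠ ξ) :
    Tendsto (fun y => bracket a U M s x ξ y) (𝓝[>] 0)
      (𝓝 (2 * Complex.I * ((1 - M ^ 2 : ℝ) : ℂ) / ((Real.pi * U : ℝ) : ℂ) * (1 / ((x - ξ : ℝ) : ℂ))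
        + (logCoeff U s * ((Real.log |x - ξ| : ℝ) : ℂ)
          + boundedPart U (1 - M ^ 2) θ (x - ξ) (wakeIntegral m θ x ξ s) s))) := by
  obtain ⟨ν, hν⟩ : ∃ ν, ν = 1 / (a * Real.sqrt (1 - M ^ 2)) := ⟨_, rfl⟩
  have hθpos : 0 < θ := by rw [hθ]; positivity
  have hmpos : 0 < m := by rw [hm]; positivity
  have hd : x - ξ ≠ 0 := sub_ne_zero.2 hx
  have hdpos : 0 < |x - ξ| := abs_pos.2 hd
  have hρ : 0 < θ * |x - ξ| := mul_pos hθpos hdpos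
  have hw := re_mul_ofReal_pos hs hρ
  have hs0 : s ≠ 0 := by rintro rfl; simp at hs
  have hUc : (U : ℂ) ≠ 0 := by exact_mod_cast hU.ne'
  have hpi : (Real.pi : ℂ) ≠ 0 := by exact_mod_cast Real.pi_ne_zero
  have hr := tendsto_radius hθpos.le ν (x - ξ)
  have harg : Tendsto (fun y => s * (radius θ ν (x - ξ) y : ℂ)) (𝓝[>] 0)
      (𝓝 (s * (θ * |x - ξ| : ℝ))) :=
    ((Complex.continuous_ofReal.tendsto _).comp hr).const_mul s
  have hK1 := (continuousAt_coshMoment 1 hw).tendsto.comp harg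
  have hK0 := (continuousAt_coshMoment 0 hw).tendsto.comp harg
  have hq : Tendsto (fun y => s * ((θ ^ 2 * (x - ξ) / radius θ ν (x - ξ) y : ℝ) : ℂ)) (𝓝[>] 0)
      (𝓝 (s * ((θ ^ 2 * (x - ξ) / (θ * |x - ξ|) : ℝ) : ℂ))) :=
    ((Complex.continuous_ofReal.tendsto _).comp (tendsto_const_nhds.div hr hρ.ne')).const_mul s
  have hlim := ((((hK1.mul hq).const_mul (((1 - M ^ 2 : ℝ) : ℂ) / U)).add
    (hK0.const_mul (s / (U : ℂ) ^ 2))).sub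
    ((tendsto_integral_wakeIntegrand hmpos.le hθpos ν x ξ hs).const_mul
      (s ^ 2 / (U : ℂ) ^ 3))).const_mul (2 * Complex.I / (Real.pi : ℂ))
  have hval : θ ^ 2 * (x - ξ) / (θ * |x - ξ|) = θ * (SignType.sign (x - ξ) : ℝ) := by
    rw [div_eq_iff hρ.ne']
    calc θ ^ 2 * (x - ξ) = θ ^ 2 * ((SignType.sign (x - ξ) : ℝ) * |x - ξ|) := by
          rw [sign_mul_abs]
      _ = _ := by ring
  have hinv : θ * (SignType.sign (x - ξ) : ℝ) * (θ * |x - ξ|)⁻¹ = 1 / (x - ξ) := by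
    rw [← hval]
    field_simp
    rw [sq_abs]
  have hreg : regularK (s * (θ * |x - ξ| : ℝ)) = coshMoment 0 (s * (θ * |x - ξ| : ℝ))
      + (Complex.log (s * θ) + (Real.log |x - ξ| : ℝ)) := by
    have h0 : s * ((θ * |x - ξ| : ℝ) : ℂ) ≠ 0 :=
      mul_ne_zero hs0 (by exact_mod_cast hρ.ne')
    have h1 : s * (θ : ℂ) ≠ 0 := mul_ne_zero hs0 (by exact_mod_cast hθpos.ne')
    rw [regularK, if_neg h0]
    congr 1
    rw [show s * ((θ * |x - ξ| : ℝ) : ℂ) = ((|x - ξ| : ℝ) : ℂ) * (s * θ) by push_cast; ring,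
      Complex.log_ofReal_mul hdpos h1]
    ring
  have hinvC : (θ : ℂ) * ((SignType.sign (x - ξ) : ℝ) : ℂ) * (((θ * |x - ξ| : ℝ) : ℂ))⁻¹
      = 1 / ((x - ξ : ℝ) : ℂ) := by
    exact_mod_cast congrArg (fun r : ℝ => (r : ℂ)) hinv
  refine (hlim.congr' ?_).trans_eq ?_
  · filter_upwards [self_mem_nhdsWithin] with y hy
    exact (bracket_eq ha hU hM hM1 hm hθ hν hs x ξ hy).symm
  · congr 1
    rw [boundedPart, logCoeff, hreg, hval, mul_inv, ← hinvC, Complex.ofReal_mul Real.pi,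
      Complex.ofReal_mul θ (SignType.sign (x - ξ) : ℝ)]
    field_simp
    ring

end Possio

end

theorem proposition4p1 (a U M : ℝ) (ha : 0 < a) (hU : 0 < U) (hM : M = U / a) (hM1 : M < 1) :
    ∃ K A B : ℝ → ℝ → ℂ → ℂ,
      -- the kernel is well defined and equals a Cauchy kernel plus `K`
      (∀ s : ℂ, 0 < s.re → ∀ x ∈ Icc (-1 : ℝ) 1, ∀ ξ ∈ Icc (-1 : ℝ) 1, x ≠ ξ →
        (∀ y : ℝ, 0 < y →
          DifferentiableAt ℝ (fun x' : ℝ => hankelZero (Possio.arg a M s ξ 0 x' y)) x ∧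
          IntegrableOn (fun u : ℝ => Complex.exp (-(Possio.lam a U M s * (u : ℂ))) *
            hankelZero (Possio.arg a M s ξ 0 u y)) (Iic x)) ∧
        Tendsto (fun y : ℝ => Possio.bracket a U M s x ξ y) (𝓝[>] 0)
          (𝓝 (2 * Complex.I * ((1 - M ^ 2 : ℝ) : ℂ) / ((Real.pi * U : ℝ) : ℂ)
              * (1 / ((x - ξ : ℝ) : ℂ)) + K x ξ s)) ∧
        K x ξ s = A x ξ s * ((Real.log |x - ξ| : ℝ) : ℂ) + B x ξ s) ∧
      -- `A` and `B` depend analytically on `s`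
      (∀ x ∈ Icc (-1 : ℝ) 1, ∀ ξ ∈ Icc (-1 : ℝ) 1,
        AnalyticOnNhd ℂ (A x ξ) {s : ℂ | 0 < s.re} ∧
        AnalyticOnNhd ℂ (B x ξ) {s : ℂ | 0 < s.re}) ∧
      -- `A` and `B` are bounded in `x, ξ`, with the bound `C |s|²`
      (∀ σ₁ : ℝ, 0 < σ₁ → ∃ C : ℝ, ∀ s : ℂ, σ₁ ≤ s.re →
        ∀ x ∈ Icc (-1 : ℝ) 1, ∀ ξ ∈ Icc (-1 : ℝ) 1,
          ‖A x ξ s‖ < C * ‖s‖ ^ 2 ∧ ‖B x ξ s‖ < C * ‖s‖ ^ 2) := by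
  have hMpos : 0 < M := by rw [hM]; positivity
  have hb : 0 < 1 - M ^ 2 := by nlinarith
  obtain ⟨θ, hθ⟩ : ∃ θ, θ = 1 / (a * (1 - M ^ 2)) := ⟨_, rfl⟩
  obtain ⟨m, hm⟩ : ∃ m, m = 1 / (U * (1 - M ^ 2)) := ⟨_, rfl⟩
  have hθpos : 0 < θ := by rw [hθ]; positivity
  have hmpos : 0 < m := by rw [hm]; positivity
  refine ⟨fun x ξ s => Possio.logCoeff U s * ((Real.log |x - ξ| : ℝ) : ℂ)
      + Possio.boundedPart U (1 - M ^ 2) θ (x - ξ) (Possio.wakeIntegral m θ x ξ s) s,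
    fun _ _ s => Possio.logCoeff U s,
    fun x ξ s => Possio.boundedPart U (1 - M ^ 2) θ (x - ξ) (Possio.wakeIntegral m θ x ξ s) s,
    fun s hs x _ ξ _ hne => ⟨fun y hy => ⟨?_, ?_⟩, ?_, rfl⟩, fun x _ ξ _ => ⟨?_, ?_⟩,
    fun σ hσ => ?_⟩
  · exact (Possio.hasDerivAt_hankelZero_arg ha hb hs ξ x hy hθ rfl).differentiableAt
  · refine IntegrableOn.congr_fun ((Possio.integrableOn_wakeIntegrand hmpos.le hθpos
      (1 / (a * Real.sqrt (1 - M ^ 2))) x ξ y hs).const_mul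
      (-(2 * Complex.I / Real.pi) * Complex.exp (-(Possio.lam a U M s * x))))
      (fun u _ => ?_) measurableSet_Iic
    exact (Possio.exp_mul_hankelZero_eq ha hU hM hb hm hθ rfl hs x ξ hy u).symm
  · exact Possio.tendsto_bracket ha hU hM hb hm hθ hs hne
  · refine DifferentiableOn.analyticOnNhd ?_ isOpen_re_pos
    unfold Possio.logCoeff
    fun_prop
  · exact (Possio.differentiableOn_boundedPart hθpos _
      (Possio.differentiableOn_wakeIntegral hmpos.le hθpos x ξ)).analyticOnNhd isOpen_re_pos
  · obtain ⟨C₁, hC₁⟩ := Possio.exists_norm_logCoeff_le U hσ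
    obtain ⟨C₂, hC₂⟩ := Possio.exists_norm_boundedPart_le U (1 - M ^ 2)
      (G := ∫ v : ℝ, macdonaldReal (σ * θ * |v|)) hθpos hσ
    refine ⟨max C₁ C₂ + 1, fun s hs x hx ξ hξ => ?_⟩
    have hs2 : 0 < ‖s‖ ^ 2 := by
      have : 0 < ‖s‖ := (hσ.trans_le hs).trans_le (Complex.re_le_norm s)
      positivity
    have hd : |x - ξ| ≤ 2 := abs_le.2 ⟨by linarith [hx.1, hξ.2], by linarith [hx.2, hξ.1]⟩
    constructor
    · refine (hC₁ s hs).trans_lt ?_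
      gcongr
      linarith [le_max_left C₁ C₂]
    · refine (hC₂ _ _ s hd (Possio.norm_wakeIntegral_le hmpos.le hθpos hσ x ξ hs) hs).trans_lt ?_
      gcongr
      linarith [le_max_right C₁ C₂]
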